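/- Fix continuous or discrete time. Let $\mathbb{C}_g$ be the open left half plane and $\Lambda_g=(-\infty,0)$ in continuous time, and let $\mathbb{C}_g$ be the open unit disc and $\Lambda_g=[0,1)$ in discrete time. A real square matrix $M$ is called asymptotically stable if $\sigma(M)\subset\mathbb{C}_g$. Consider the system $\Sigma$ $$\mathcal{D}x(t)=Ax(t)+Bu(t),\qquad y(t)=Cx(t)+Du(t),$$ with $x(t)\in\mathbb{R}^n$, $u(t)\in\mathbb{R}^m$, $y(t)\in\mathbb{R}^p$ and real matrices $A,B,C,D$, where $\mathcal{D}x=\dot x$ ($t\in[0,\infty)$) in continuous time and $(\mathcal{D}x)(t)=x(t+1)$ ($t\in\mathbb{N}=\{0,1,\dots\}$) in discrete time. Assume that the columns of $\begin{bmatrix}B\\D\end{bmatrix}$ are linearly independent and that the rows of $[\,C\ \ D\,]$ are linearly independent. Let $P_\Sigma(z)=\begin{bmatrix}A-zI_n&B\\C&D\end{bmatrix}$. The set $\mathcal{Z}$ of invariant zeros of $\Sigma$ consists of the $z\in\mathbb{C}$ for which $\operatorname{rank}P_\Sigma(z)<\max_{\mu\in\mathbb{C}}\operatorname{rank}P_\Sigma(\mu)$.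 The algebraic multiplicity of an invariant zero $z$ is its multiplicity as a root of the product of the nonzero diagonal entries of the Smith form of $P_\Sigma$. Let $\mathcal{V}^\star_g$ be the largest subspace $\mathcal{V}\subseteq\mathbb{R}^n$ for which there is an $F\in\mathbb{R}^{m\times n}$ with $(A+BF)\mathcal{V}\subseteq\mathcal{V}\subseteq\ker(C+DF)$ and $\sigma((A+BF)|_{\mathcal{V}})\subset\mathbb{C}_g$. For $j\in\{1,\dots,p\}$ let $C_{(j)},D_{(j)}$ be $C,D$ with the $j$-th row deleted, and for $\mu\in\mathbb{R}\setminus\mathcal{Z}$ let $$\mathcal{R}^\star_j(\mu)=\Big\{v\in\mathbb{R}^n:\ \exists\,w\in\mathbb{R}^m,\ \begin{bmatrix}A-\mu I_n&B\\C_{(j)}&D_{(j)}\end{bmatrix}\begin{bmatrix}v\\w\end{bmatrix}=0\Big\}.$$ **Theorem.** Assume that 1. $\Sigma$ is right invertible (its transfer matrix $C(sI-A)^{-1}B+D$ has a right inverse over $\mathbb{R}(s)$) and stabilisable ($A+BF$ is asymptotically stable for some real $F$), and $\Sigma$ has no invariant zero at $0$ in continuous time, respectively at $1$ in discrete time; 2.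 every invariant zero of $\Sigma$ in $\mathbb{C}_g$ has algebraic multiplicity one; 3. $\dim\mathcal{V}^\star_g=n-p$; 4. $\lambda_1,\dots,\lambda_p\in\Lambda_g\setminus\mathcal{Z}$ (not necessarily distinct). Then the following are equivalent. (a) There is $F\in\mathbb{R}^{m\times n}$ such that $A+BF$ is asymptotically stable and such that, for every reference $r\in\mathbb{R}^p$, every pair $(x_{ss},u_{ss})$ with $r=Cx_{ss}+Du_{ss}$ and $0=Ax_{ss}+Bu_{ss}$ (continuous time) respectively $x_{ss}=Ax_{ss}+Bu_{ss}$ (discrete time), and every initial state $x(0)\in\mathbb{R}^n$, the control law $u(t)=F(x(t)-x_{ss})+u_{ss}$ applied to $\Sigma$ yields a tracking error $\epsilon(t)=y(t)-r$ for which there are $\beta_1,\dots,\beta_p\in\mathbb{R}$ with $$\epsilon_k(t)=\beta_k e^{\lambda_k t}\ (t\ge 0)\qquad\text{respectively}\qquad \epsilon_k(t)=\beta_k\lambda_k^{t}\ (t\in\mathbb{N},\ 0^0=1)$$ for all $k\in\{1,\dots,p\}$. (b) For every subset $S\subseteq\{1,\dots,p\}$, $$\dim\Big(\mathcal{V}^\star_g+\sum_{j\in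 S}\mathcal{R}^\star_j(\lambda_j)\Big)\ \ge\ (n-p)+\operatorname{card}(S).$$ -/

import Mathlib

open Matrix Module

noncomputable section

/-- Whether the time axis is the half line of nonnegative reals or the natural numbers. -/
inductive TimeDomain where
  | continuous
  | discrete

namespace TimeDomain

/-- The stability region `ℂ_g`: the open left half plane, or the open unit disc. -/
def goodRegion : TimeDomain → Set ℂ
  | continuous => {z | z.re < 0}
  | discrete => {z | ‖z‖ < 1}

/-- The set `Λ_g` of admissible real modes: `(-∞, 0)`, or `[0, 1)`. -/
def goodReals : TimeDomain → Set ℝ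
  | continuous => Set.Iio 0
  | discrete => Set.Ico 0 1

/-- The frequency of constant signals: a constant state `x` has `𝒟 x = freq • x`. -/
def constFreq : TimeDomain → ℝ
  | continuous => 0
  | discrete => 1

end TimeDomain

/-- A real square matrix is asymptotically stable if its complex spectrum lies in `ℂ_g`. -/
def IsAsympStable (td : TimeDomain) {n : ℕ} (M : Matrix (Fin n) (Fin n) ℝ) : Prop :=
  spectrum ℂ (M.map (algebraMap ℝ ℂ)) ⊆ td.goodRegion

/-- `d` is the diagonal of the Smith form of the polynomial matrix `M`: for some unimodular `U`
and `V`, the matrix `U * M * V` is (rectangular) diagonal with diagonal `d`, each entry of `d`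
divides the later ones, and the nonzero entries are monic. -/
def IsSmithDiagonal {a b : ℕ} (M : Matrix (Fin a) (Fin b) (Polynomial ℂ))
    (d : Fin (min a b) → Polynomial ℂ) : Prop :=
  (∃ (U : Matrix (Fin a) (Fin a) (Polynomial ℂ)) (V : Matrix (Fin b) (Fin b) (Polynomial ℂ)),
    IsUnit U.det ∧ IsUnit V.det ∧
    U * M * V = Matrix.of fun (i : Fin a) (j : Fin b) =>
      if h : (i : ℕ) = (j : ℕ) then d ⟨i, lt_min i.isLt (h ▸ j.isLt)⟩ else 0) ∧
  (∀ i j, i ≤ j → d i ∣ d j) ∧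
  (∀ i, d i = 0 ∨ (d i).Monic)

/-- The quadruple `(A, B, C, D)` with `n` states, `m` inputs and outputs indexed by `q`. -/
structure LTISystem (n m : ℕ) (q : Type) where
  A : Matrix (Fin n) (Fin n) ℝ
  B : Matrix (Fin n) (Fin m) ℝ
  C : Matrix q (Fin n) ℝ
  D : Matrix q (Fin m) ℝ

namespace LTISystem

/-- The Rosenbrock system matrix `[A - z I, B; C, D]`, with `z` in any real algebra `R` (used
for `R = ℝ`, `R = ℂ`, and `R = ℂ[X]` with `z = X`). -/
def rosenbrock {n m : ℕ} {q : Type} (sys : LTISystem n m q) {R : Type} [CommRing R] [Algebra ℝ R]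
    (z : R) : Matrix (Fin n ⊕ q) (Fin n ⊕ Fin m) R :=
  Matrix.fromBlocks (sys.A.map (algebraMap ℝ R) - z • (1 : Matrix (Fin n) (Fin n) R))
    (sys.B.map (algebraMap ℝ R)) (sys.C.map (algebraMap ℝ R)) (sys.D.map (algebraMap ℝ R))

/-- The normal rank of the Rosenbrock matrix: the maximum of its rank over `z ∈ ℂ`. -/
def normalRank {n m : ℕ} {q : Type} (sys : LTISystem n m q) : ℕ :=
  ⨆ z : ℂ, (sys.rosenbrock z).rank

/-- The set of invariant zeros. -/
def invariantZeros {n m : ℕ} {q : Type} (sys : LTISystem n m q) : Set ℂ :=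
  {z | (sys.rosenbrock z).rank < sys.normalRank}

/-- The algebraic multiplicity of `z` as an invariant zero is `k`: the elementary divisors
`(X - z) ^ e` contained in the nonzero diagonal entries of the Smith form of the Rosenbrock
pencil have a product of degree `k`. -/
def HasZeroMultiplicity {n m p : ℕ} (sys : LTISystem n m (Fin p)) (z : ℂ) (k : ℕ) : Prop :=
  ∃ d : Fin (min (n + p) (n + m)) → Polynomial ℂ,
    IsSmithDiagonal (Matrix.reindex finSumFinEquiv finSumFinEquiv
      (sys.rosenbrock (Polynomial.X : Polynomial ℂ))) d ∧
    ∑ i, (d i).rootMultiplicity z = k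

/-- The transfer matrix `C (s I - A)⁻¹ B + D` over the field of real rational functions. -/
def transferMatrix {n m : ℕ} {q : Type} (sys : LTISystem n m q) : Matrix q (Fin m) (RatFunc ℝ) :=
  sys.C.map (algebraMap ℝ (RatFunc ℝ)) *
      ((RatFunc.X : RatFunc ℝ) • (1 : Matrix (Fin n) (Fin n) (RatFunc ℝ)) -
        sys.A.map (algebraMap ℝ (RatFunc ℝ)))⁻¹ *
      sys.B.map (algebraMap ℝ (RatFunc ℝ)) +
    sys.D.map (algebraMap ℝ (RatFunc ℝ))

/-- Right invertibility: the transfer matrix has a rational right inverse. -/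
def IsRightInvertible {n m : ℕ} {q : Type} [DecidableEq q] (sys : LTISystem n m q) : Prop :=
  ∃ K : Matrix (Fin m) q (RatFunc ℝ), sys.transferMatrix * K = 1

/-- Stabilisability of the pair `(A, B)`. -/
def IsStabilisable {n m : ℕ} {q : Type} (td : TimeDomain) (sys : LTISystem n m q) : Prop :=
  ∃ F : Matrix (Fin m) (Fin n) ℝ, IsAsympStable td (sys.A + sys.B * F)

/-- The standing conventions: the columns of `[B; D]` and the rows of `[C, D]` are linearly
independent. -/
def IsNonredundant {n m : ℕ} {q : Type} (sys : LTISystem n m q) : Prop :=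
  LinearIndependent ℝ (Matrix.fromRows sys.B sys.D).col ∧
  LinearIndependent ℝ (Matrix.fromCols sys.C sys.D).row

/-- The system is right invertible and stabilisable and has no invariant zero at `0`
(continuous time), respectively at `1` (discrete time). -/
def TrackingAssumption {n m p : ℕ} (td : TimeDomain) (sys : LTISystem n m (Fin p)) : Prop :=
  sys.IsRightInvertible ∧ sys.IsStabilisable td ∧ (td.constFreq : ℂ) ∉ sys.invariantZeros

/-- The minimum-phase invariant zeros all have algebraic multiplicity one. -/
def DistinctGoodZeros {n m p : ℕ} (td : TimeDomain) (sys : LTISystem n m (Fin p)) : Prop :=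
  ∀ z ∈ sys.invariantZeros ∩ td.goodRegion, sys.HasZeroMultiplicity z 1

/-- `V` is a stabilisability output-nulling subspace: for some `F`, `V` is invariant under
`A + B F`, contained in `ker (C + D F)`, and the restriction of `A + B F` to `V` has its
complex eigenvalues in `ℂ_g`. -/
def IsStabOutputNulling {n m : ℕ} {q : Type} (td : TimeDomain) (sys : LTISystem n m q)
    (V : Submodule ℝ (Fin n → ℝ)) : Prop :=
  ∃ F : Matrix (Fin m) (Fin n) ℝ,
    ∃ h : ∀ v ∈ V, (sys.A + sys.B * F).mulVecLin v ∈ V,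
      (∀ v ∈ V, (sys.C + sys.D * F) *ᵥ v = 0) ∧
      ∀ z ∈ (((sys.A + sys.B * F).mulVecLin).restrict h).charpoly.aroots ℂ, z ∈ td.goodRegion

/-- `𝒱⋆_g`, the largest stabilisability output-nulling subspace, as the supremum of all of them
(this family is closed under sums, so that the supremum is its largest member). -/
def Vg {n m : ℕ} {q : Type} (td : TimeDomain) (sys : LTISystem n m q) :
    Submodule ℝ (Fin n → ℝ) :=
  sSup {V | sys.IsStabOutputNulling td V}

/-- `ℛ⋆(μ)`: the states `v` such that some `w` puts `(v, w)` in the kernel of the Rosenbrock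
matrix at `μ`. -/
def Rstar {n m : ℕ} {q : Type} (sys : LTISystem n m q) (μ : ℝ) :
    Submodule ℝ (Fin n → ℝ) where
  carrier := {v | ∃ w : Fin m → ℝ, sys.rosenbrock μ *ᵥ Sum.elim v w = 0}
  zero_mem' := ⟨0, by simp [Sum.elim_zero_zero]⟩
  add_mem' := by
    rintro v v' ⟨w, hw⟩ ⟨w', hw'⟩
    refine ⟨w + w', ?_⟩
    rw [Sum.elim_add_add, Matrix.mulVec_add, hw, hw', add_zero]
  smul_mem' := by
    rintro c v ⟨w, hw⟩
    refine ⟨c • w, ?_⟩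
    have h : Sum.elim (c • v) (c • w) = c • Sum.elim v w := by
      ext i
      cases i <;> rfl
    rw [h, Matrix.mulVec_smul, hw, smul_zero]

/-- `Σ_j`, obtained by deleting the `j`-th output. -/
def dropOutput {n m p : ℕ} (sys : LTISystem n m (Fin p)) (j : Fin p) :
    LTISystem n m {i : Fin p // i ≠ j} where
  A := sys.A
  B := sys.B
  C := sys.C.submatrix Subtype.val id
  D := sys.D.submatrix Subtype.val id

/-- The steady-state equations for the constant reference `r`: `(xs, us)` is an equilibrium
pair with output `r`. -/
def IsSteadyState {n m p : ℕ} (td : TimeDomain) (sys : LTISystem n m (Fin p))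
    (r : Fin p → ℝ) (xs : Fin n → ℝ) (us : Fin m → ℝ) : Prop :=
  td.constFreq • xs = sys.A *ᵥ xs + sys.B *ᵥ us ∧ r = sys.C *ᵥ xs + sys.D *ᵥ us

/-- The control law `u = F (x - xs) + us`. -/
def control {n m : ℕ} (F : Matrix (Fin m) (Fin n) ℝ) (xs : Fin n → ℝ) (us : Fin m → ℝ)
    (x : Fin n → ℝ) : Fin m → ℝ :=
  F *ᵥ (x - xs) + us

/-- For every state trajectory (hence every initial condition) of the system under the control
law `u = F (x - xs) + us`, the tracking error `y - r` has the single mode `lam k` in its `k`-th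
component: it is `β k * exp (lam k * t)`, respectively `β k * lam k ^ t`. -/
def HasSingleModeErrors {n m p : ℕ} (td : TimeDomain) (sys : LTISystem n m (Fin p))
    (F : Matrix (Fin m) (Fin n) ℝ) (lam : Fin p → ℝ)
    (r : Fin p → ℝ) (xs : Fin n → ℝ) (us : Fin m → ℝ) : Prop :=
  match td with
  | TimeDomain.continuous =>
      ∀ x : ℝ → Fin n → ℝ,
        (∀ t : ℝ, 0 ≤ t → HasDerivWithinAt x
          (sys.A *ᵥ x t + sys.B *ᵥ control F xs us (x t)) (Set.Ici 0) t) →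
        ∃ β : Fin p → ℝ, ∀ t : ℝ, 0 ≤ t → ∀ k : Fin p,
          (sys.C *ᵥ x t + sys.D *ᵥ control F xs us (x t) - r) k = β k * Real.exp (lam k * t)
  | TimeDomain.discrete =>
      ∀ x : ℕ → Fin n → ℝ,
        (∀ t : ℕ, x (t + 1) = sys.A *ᵥ x t + sys.B *ᵥ control F xs us (x t)) →
        ∃ β : Fin p → ℝ, ∀ t : ℕ, ∀ k : Fin p,
          (sys.C *ᵥ x t + sys.D *ᵥ control F xs us (x t) - r) k = β k * lam k ^ t

/-- Solvability of the monotonic tracking problem with prescribed modes `lam`: one feedback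
matrix `F` makes the closed loop asymptotically stable and, for all step references and all
initial conditions, produces a tracking error with the single mode `lam k` in component `k`. -/
def MonotonicTrackingSolvable {n m p : ℕ} (td : TimeDomain) (sys : LTISystem n m (Fin p))
    (lam : Fin p → ℝ) : Prop :=
  ∃ F : Matrix (Fin m) (Fin n) ℝ,
    IsAsympStable td (sys.A + sys.B * F) ∧
    ∀ (r : Fin p → ℝ) (xs : Fin n → ℝ) (us : Fin m → ℝ),
      sys.IsSteadyState td r xs us → sys.HasSingleModeErrors td F lam r xs us

end LTISystem

end

/-! Condition (a) is algebraic: it says that `A + B F` is stable and that each row of `L = C + D F`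
satisfies `L_k (A + B F) = λ_k L_k` (`rows_of_hasSingleModeErrors`, `hasSingleModeErrors_of_rows`).

Given such an `F`, `ker L` is invariant, stable and of dimension at least `n - p`, so it equals
`𝒱⋆_g` and `L` is onto. A vector `v₀` with `L v₀ = e_j` is a `λ_j`-mode up to an error in `𝒱⋆_g`. As
`λ_j` is not an invariant zero, the Rosenbrock matrix is onto and supplies a correction cancelling
this error, which itself lies in `𝒱⋆_g` (`mem_Vg_of_mode`). So `ℛ⋆_j(λ_j)` meets the preimage of
`e_j`, and counting dimensions gives (b) (`card_le_finrank_of_rows`).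

Conversely, (b) is Rado's condition modulo `𝒱⋆_g`: some `v_j ∈ ℛ⋆_j(λ_j)` form a basis of the
quotient. The feedback that keeps a stabilising choice on `𝒱⋆_g` and sends `v_j` to its matching
input acts on the quotient as `diag(λ_j)`, and row `k` of `L` becomes a multiple of the `k`-th
coordinate (`exists_feedback_of_modes`).

Both directions need `𝒱⋆_g` to be stabilisability output-nulling itself, hence closure under sums. A
Lyapunov form gives this: a stable exosystem compresses stably to the orthogonal complement of the
kernel of its state map (`IsStabOutputNulling.of_parametrisation`). -/

/-! ### Complex spectra of real operators through real pairs -/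

/-- A real square matrix has the complex eigenvector `x + i y` for `a + i b`. -/
theorem Matrix.complex_eigenvector_iff {ι : Type*} [Fintype ι] (M : Matrix ι ι ℝ) (z : ℂ) :
    (∃ v : ι → ℂ, v ≠ 0 ∧ M.map (algebraMap ℝ ℂ) *ᵥ v = z • v) ↔
      ∃ x y : ι → ℝ, (x ≠ 0 ∨ y ≠ 0) ∧ M *ᵥ x = z.re • x - z.im • y ∧
        M *ᵥ y = z.im • x + z.re • y := by
  have key : ∀ v : ι → ℂ, M.map (algebraMap ℝ ℂ) *ᵥ v = z • v ↔
      M *ᵥ (fun i => (v i).re) = z.re • (fun i => (v i).re) - z.im • (fun i => (v i).im) ∧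
      M *ᵥ (fun i => (v i).im) = z.im • (fun i => (v i).re) + z.re • (fun i => (v i).im) := by
    intro v
    simp only [funext_iff, ← forall_and]
    refine forall_congr' fun i => ?_
    rw [Complex.ext_iff]
    simp [Matrix.mulVec, dotProduct, Complex.re_sum, Complex.im_sum, add_comm]
  constructor
  · rintro ⟨v, hv, h⟩
    refine ⟨_, _, ?_, (key v).1 h⟩
    by_contra! hc
    apply hv
    ext i
    exact Complex.ext (congrFun hc.1 i) (congrFun hc.2 i)
  · rintro ⟨x, y, hxy, h⟩
    refine ⟨fun i => ⟨x i, y i⟩, ?_, (key _).2 h⟩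
    intro hv
    rcases hxy with hx | hy
    · exact hx (funext fun i => congrArg Complex.re (congrFun hv i))
    · exact hy (funext fun i => congrArg Complex.im (congrFun hv i))

theorem Matrix.mem_spectrum_iff_exists_mulVec {ι K : Type*} [Fintype ι] [DecidableEq ι] [Field K]
    (M : Matrix ι ι K) (z : K) : z ∈ spectrum K M ↔ ∃ v : ι → K, v ≠ 0 ∧ M *ᵥ v = z • v := by
  rw [← Matrix.spectrum_toLin', ← Module.End.hasEigenvalue_iff_mem_spectrum]
  constructor
  · intro h
    obtain ⟨v, hv⟩ := h.exists_hasEigenvector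
    exact ⟨v, hv.2, by simpa using hv.apply_eq_smul⟩
  · rintro ⟨v, hv, h⟩
    exact Module.End.hasEigenvalue_of_hasEigenvector
      ⟨Module.End.mem_eigenspace_iff.2 (by simpa using h), hv⟩

/-- Complex eigenvectors are carried as real pairs, so that stability on real subspaces can be
handled without complexifying them. -/
theorem LinearMap.mem_aroots_charpoly_iff {E : Type*} [AddCommGroup E] [Module ℝ E]
    [FiniteDimensional ℝ E] (T : E →ₗ[ℝ] E) (z : ℂ) :
    z ∈ T.charpoly.aroots ℂ ↔
      ∃ x y : E, (x ≠ 0 ∨ y ≠ 0) ∧ T x = z.re • x - z.im • y ∧ T y = z.im • x + z.re • y := by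
  let b := finBasis ℝ E
  have h1 : z ∈ T.charpoly.aroots ℂ ↔
      z ∈ spectrum ℂ ((LinearMap.toMatrix b b T).map (algebraMap ℝ ℂ)) := by
    rw [Matrix.mem_spectrum_iff_isRoot_charpoly, Matrix.charpoly_map, LinearMap.charpoly_toMatrix,
      Polynomial.mem_aroots, Polynomial.IsRoot, Polynomial.eval_map_algebraMap]
    exact and_iff_right T.charpoly_monic.ne_zero
  rw [h1, Matrix.mem_spectrum_iff_exists_mulVec, Matrix.complex_eigenvector_iff]
  have hb : ∀ x : E, LinearMap.toMatrix b b T *ᵥ b.equivFun x = b.equivFun (T x) := by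
    intro x
    exact LinearMap.toMatrix_mulVec_repr b b T x
  have hne : ∀ x : E, b.equivFun x ≠ 0 ↔ x ≠ 0 := fun x => by simp
  constructor
  · rintro ⟨x, y, hxy, hx, hy⟩
    obtain ⟨x, rfl⟩ := b.equivFun.surjective x
    obtain ⟨y, rfl⟩ := b.equivFun.surjective y
    rw [hne, hne] at hxy
    refine ⟨x, y, hxy, b.equivFun.injective ?_, b.equivFun.injective ?_⟩
    · rw [← hb, hx]; simp
    · rw [← hb, hy]; simp
  · rintro ⟨x, y, hxy, hx, hy⟩
    refine ⟨b.equivFun x, b.equivFun y, by rwa [hne, hne], ?_, ?_⟩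
    · rw [hb, hx]; simp
    · rw [hb, hy]; simp

/-- All complex eigenvalues of `T` with an eigenvector `x + i y`, `x, y ∈ V`, are in `ℂ_g`. -/
def StableOn {E : Type*} [AddCommGroup E] [Module ℝ E] (td : TimeDomain) (T : E →ₗ[ℝ] E)
    (V : Submodule ℝ E) : Prop :=
  ∀ z : ℂ, ∀ x ∈ V, ∀ y ∈ V, (x ≠ 0 ∨ y ≠ 0) → T x = z.re • x - z.im • y →
    T y = z.im • x + z.re • y → z ∈ td.goodRegion

theorem isAsympStable_iff_stableOn {td : TimeDomain} {n : ℕ} {M : Matrix (Fin n) (Fin n) ℝ} :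
    IsAsympStable td M ↔ StableOn td M.mulVecLin ⊤ := by
  constructor
  · intro h z x _ y _ hxy hx hy
    refine h ?_
    rw [Matrix.mem_spectrum_iff_exists_mulVec, Matrix.complex_eigenvector_iff]
    exact ⟨x, y, hxy, hx, hy⟩
  · intro h z hz
    rw [Matrix.mem_spectrum_iff_exists_mulVec, Matrix.complex_eigenvector_iff] at hz
    obtain ⟨x, y, hxy, hx, hy⟩ := hz
    exact h z x trivial y trivial hxy hx hy

theorem stableOn_iff_restrict {E : Type*} [AddCommGroup E] [Module ℝ E] [FiniteDimensional ℝ E]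
    {td : TimeDomain} {T : E →ₗ[ℝ] E} {V : Submodule ℝ E} (h : ∀ v ∈ V, T v ∈ V) :
    StableOn td T V ↔ ∀ z ∈ (T.restrict h).charpoly.aroots ℂ, z ∈ td.goodRegion := by
  constructor
  · intro hs z hz
    rw [LinearMap.mem_aroots_charpoly_iff] at hz
    obtain ⟨x, y, hxy, hx, hy⟩ := hz
    refine hs z x x.2 y y.2 (by simpa using hxy) ?_ ?_
    · simpa using congrArg Subtype.val hx
    · simpa using congrArg Subtype.val hy
  · intro hs z x hx y hy hxy h1 h2
    refine hs z ((LinearMap.mem_aroots_charpoly_iff _ _).2 ⟨⟨x, hx⟩, ⟨y, hy⟩, ?_, ?_, ?_⟩)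
    · simpa using hxy
    · exact Subtype.ext h1
    · exact Subtype.ext h2

theorem StableOn.restrict {E : Type*} [AddCommGroup E] [Module ℝ E]
    {td : TimeDomain} {T : E →ₗ[ℝ] E} {V : Submodule ℝ E} (hs : StableOn td T V)
    (h : ∀ v ∈ V, T v ∈ V) : StableOn td (T.restrict h) ⊤ := by
  intro z x _ y _ hxy hx hy
  refine hs z x x.2 y y.2 (by simpa using hxy) ?_ ?_
  · simpa using congrArg Subtype.val hx
  · simpa using congrArg Subtype.val hy

/-- Stability passes from an invariant subspace and a diagonal quotient to the whole. -/
theorem StableOn.of_diagonal_quotient {E ι : Type*} [AddCommGroup E] [Module ℝ E]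
    {td : TimeDomain} {T T' : E →ₗ[ℝ] E} {V W : Submodule ℝ E} (hV : StableOn td T' V)
    (hT : ∀ v ∈ V, T v = T' v) (φ : E →ₗ[ℝ] ι → ℝ) (lam : ι → ℝ)
    (hlam : ∀ i, (lam i : ℂ) ∈ td.goodRegion) (hφ : ∀ w ∈ W, φ w = 0 → w ∈ V)
    (hφT : ∀ w ∈ W, ∀ i, φ (T w) i = lam i * φ w i) : StableOn td T W := by
  intro z x hx y hy hxy h1 h2
  by_cases h : φ x = 0 ∧ φ y = 0
  · have hxV := hφ x hx h.1
    have hyV := hφ y hy h.2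
    exact hV z x hxV y hyV hxy (by rw [← hT x hxV, h1]) (by rw [← hT y hyV, h2])
  -- The nonzero number `φ x i + i φ y i` is scaled both by `z` and by `lam i`, so the two agree.
  -- The combinations below are this identity multiplied by the conjugate.
  · obtain ⟨i, hi⟩ : ∃ i, φ x i ≠ 0 ∨ φ y i ≠ 0 := by
      by_contra! hc
      exact h ⟨funext fun i => (hc i).1, funext fun i => (hc i).2⟩
    have e1 := hφT x hx i
    have e2 := hφT y hy i
    rw [h1] at e1
    rw [h2] at e2
    simp only [map_sub, map_add, map_smul, Pi.sub_apply, Pi.add_apply, Pi.smul_apply,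
      smul_eq_mul] at e1 e2
    have hpos : 0 < φ x i ^ 2 + φ y i ^ 2 := by
      rcases hi with hi | hi <;> positivity
    have him : z.im = 0 := by
      have : z.im * (φ x i ^ 2 + φ y i ^ 2) = 0 := by linear_combination φ x i * e2 - φ y i * e1
      exact (mul_eq_zero.1 this).resolve_right hpos.ne'
    have hre : z.re = lam i := by
      have : (z.re - lam i) * (φ x i ^ 2 + φ y i ^ 2) = 0 := by
        linear_combination φ x i * e1 + φ y i * e2
      exact sub_eq_zero.1 ((mul_eq_zero.1 this).resolve_right hpos.ne')
    have : z = (lam i : ℂ) := Complex.ext (by simpa using hre) (by simpa using him)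
    exact this ▸ hlam i

theorem TimeDomain.goodReals_subset {td : TimeDomain} {r : ℝ} (h : r ∈ td.goodReals) :
    (r : ℂ) ∈ td.goodRegion := by
  cases td
  · simpa [TimeDomain.goodReals, TimeDomain.goodRegion] using h
  · simp only [TimeDomain.goodReals, TimeDomain.goodRegion, Set.mem_Ico, Set.mem_ofPred_eq,
      Complex.norm_real, Real.norm_eq_abs] at h ⊢
    rw [abs_of_nonneg h.1]
    exact h.2

/-! ### Lyapunov forms and stable compressions -/

section Lyapunov

-- By Gelfand's formula `‖M ^ N‖ ^ (1 / N)` tends to the spectral radius, which is below one.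
open scoped Matrix.Norms.L2Operator in
theorem Matrix.exists_pow_norm_lt_one {ι : Type*} [Fintype ι] [DecidableEq ι] [Nonempty ι]
    (M : Matrix ι ι ℂ) (h : ∀ z ∈ spectrum ℂ M, ‖z‖ < 1) : ∃ N : ℕ, ‖M ^ N‖ < 1 := by
  have : CompleteSpace (Matrix ι ι ℂ) := FiniteDimensional.complete ℂ _
  have h1 : spectralRadius ℂ M < ((1 : NNReal) : ENNReal) :=
    spectrum.spectralRadius_lt_of_forall_lt_of_nonempty (spectrum.nonempty_of_isAlgClosed_of_finiteDimensional ℂ M)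
      (fun k hk => by exact_mod_cast h k hk)
  have h2 := spectrum.pow_nnnorm_pow_one_div_tendsto_nhds_spectralRadius M
  have h3 := (h2.eventually_lt_const h1).and (Filter.eventually_ge_atTop 1)
  obtain ⟨N, hN, hN1⟩ := h3.exists
  refine ⟨N, ?_⟩
  rw [ENNReal.coe_one] at hN
  by_contra! hc
  have : (1 : ENNReal) ≤ (‖M ^ N‖₊ : ENNReal) := by exact_mod_cast hc
  exact absurd hN (not_lt.2 (ENNReal.one_le_rpow this (by positivity)))

open scoped Matrix.Norms.L2Operator in
theorem Matrix.exists_pow_contracting {ι : Type*} [Fintype ι] [DecidableEq ι] (M : Matrix ι ι ℝ)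
    (h : ∀ z ∈ spectrum ℂ (M.map (algebraMap ℝ ℂ)), ‖z‖ < 1) :
    ∃ N : ℕ, ∀ x : ι → ℝ, x ≠ 0 → (M ^ N *ᵥ x) ⬝ᵥ (M ^ N *ᵥ x) < x ⬝ᵥ x := by
  rcases isEmpty_or_nonempty ι with hι | hι
  · exact ⟨0, fun x hx => (hx (Subsingleton.elim _ _)).elim⟩
  obtain ⟨N, hN⟩ := Matrix.exists_pow_norm_lt_one _ h
  refine ⟨N, fun x hx => ?_⟩
  have hnorm : ∀ x : ι → ℝ, ‖WithLp.toLp 2 (fun i => (x i : ℂ))‖ ^ 2 = x ⬝ᵥ x := by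
    intro x
    rw [EuclideanSpace.norm_sq_eq]
    simp [dotProduct, sq]
  have hmul : (M.map (algebraMap ℝ ℂ)) ^ N *ᵥ (fun i => (x i : ℂ)) =
      fun i => ((M ^ N *ᵥ x) i : ℂ) := by
    rw [← Matrix.map_pow]
    ext i
    simp [Matrix.mulVec, dotProduct]
  have h1 := Matrix.l2_opNorm_mulVec ((M.map (algebraMap ℝ ℂ)) ^ N)
    (WithLp.toLp 2 (fun i => (x i : ℂ)))
  have hpos : 0 < x ⬝ᵥ x := by
    have := dotProduct_star_self_pos_iff (v := x)
    simpa using this.2 hx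
  rw [← hnorm, ← hnorm, ← hmul]
  rw [← hnorm] at hpos
  have hpos' : 0 < ‖WithLp.toLp 2 (fun i => (x i : ℂ))‖ := by
    by_contra! hc
    have : ‖WithLp.toLp 2 (fun i => (x i : ℂ))‖ = 0 := le_antisymm hc (norm_nonneg _)
    simp [this] at hpos
  refine pow_lt_pow_left₀ (lt_of_le_of_lt h1 ?_) (norm_nonneg _) two_ne_zero
  nlinarith

variable {E : Type*} [AddCommGroup E] [Module ℝ E]

/-- The operator `T` strictly dissipates, respectively strictly contracts, the form `q`. -/
def IsLyapunov (td : TimeDomain) (T : E →ₗ[ℝ] E) (q : LinearMap.BilinForm ℝ E) : Prop :=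
  match td with
  | TimeDomain.continuous => ∀ x, x ≠ 0 → q x (T x) < 0
  | TimeDomain.discrete => ∀ x, x ≠ 0 → q (T x) (T x) < q x x

/-- Sum a Euclidean form `e` along the first `N` iterates, where `T ^ N` contracts `e`. Applying `T`
telescopes the sum, so the change is `e (T ^ N x) (T ^ N x) - e x x < 0`. -/
theorem exists_isLyapunov_discrete [FiniteDimensional ℝ E] {T : E →ₗ[ℝ] E}
    (hT : StableOn TimeDomain.discrete T ⊤) :
    ∃ q : LinearMap.BilinForm ℝ E, q.IsSymm ∧ (∀ x, x ≠ 0 → 0 < q x x) ∧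
      ∀ x, x ≠ 0 → q (T x) (T x) < q x x := by
  let b := finBasis ℝ E
  have hbN : ∀ (N : ℕ) (x : E), LinearMap.toMatrix b b T ^ N *ᵥ b.equivFun x =
      b.equivFun ((T ^ N) x) := by
    intro N x
    rw [LinearMap.toMatrix_pow]
    exact LinearMap.toMatrix_mulVec_repr b b (T ^ N) x
  obtain ⟨N, hN⟩ := Matrix.exists_pow_contracting (LinearMap.toMatrix b b T) (by
    intro z hz
    rw [Matrix.mem_spectrum_iff_isRoot_charpoly, Matrix.charpoly_map, LinearMap.charpoly_toMatrix,
      Polynomial.IsRoot, Polynomial.eval_map_algebraMap] at hz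
    obtain ⟨x, y, hxy, hx, hy⟩ := (LinearMap.mem_aroots_charpoly_iff T z).1
      ((Polynomial.mem_aroots).2 ⟨T.charpoly_monic.ne_zero, hz⟩)
    exact hT z x trivial y trivial hxy hx hy)
  obtain ⟨e, he⟩ : ∃ e : LinearMap.BilinForm ℝ E,
      ∀ x y, e x y = b.equivFun x ⬝ᵥ b.equivFun y :=
    ⟨(dotProductBilin ℝ ℝ).compl₁₂ b.equivFun.toLinearMap b.equivFun.toLinearMap,
      fun x y => rfl⟩
  obtain ⟨q, hq⟩ : ∃ q : LinearMap.BilinForm ℝ E,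
      ∀ x y, q x y = ∑ k ∈ Finset.range N, e ((T ^ k) x) ((T ^ k) y) :=
    ⟨∑ k ∈ Finset.range N, e.compl₁₂ (T ^ k) (T ^ k), fun x y => by
      simp [LinearMap.sum_apply]⟩
  have hpos : ∀ x, x ≠ 0 → 0 < e x x := by
    intro x hx
    have := dotProduct_star_self_pos_iff (v := b.equivFun x)
    rw [he]
    simpa using this.2 (by simpa using hx)
  have hnn : ∀ x, 0 ≤ e x x := by
    intro x
    by_cases hx : x = 0
    · simp [hx]
    · exact (hpos x hx).le
  have hstep : ∀ x, x ≠ 0 → e ((T ^ N) x) ((T ^ N) x) < e x x := by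
    intro x hx
    have := hN (b.equivFun x) (by simpa using hx)
    rwa [hbN, ← he, ← he] at this
  refine ⟨q, ⟨fun x y => ?_⟩, fun x hx => ?_, fun x hx => ?_⟩
  · rw [hq, hq]
    refine Finset.sum_congr rfl fun k _ => ?_
    rw [he, he, dotProduct_comm]
  -- `T ^ 0` does not contract strictly, so the sum contains the term `k = 0`, which is positive.
  · have hN0 : 0 < N := by
      by_contra! hc
      obtain rfl : N = 0 := by omega
      simpa using hstep x hx
    rw [hq]
    refine lt_of_lt_of_le (hpos x hx) ?_
    exact Finset.single_le_sum (f := fun k => e ((T ^ k) x) ((T ^ k) x)) (fun k _ => hnn _)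
      (Finset.mem_range.2 hN0)
  · have h1 := Finset.sum_range_succ (fun k => e ((T ^ k) x) ((T ^ k) x)) N
    have h2 := Finset.sum_range_succ' (fun k => e ((T ^ k) x) ((T ^ k) x)) N
    rw [hq, hq]
    have h3 : ∀ k, (T ^ (k + 1)) x = (T ^ k) (T x) := fun k => by
      rw [pow_succ]; rfl
    simp only [h3] at h2
    have := hstep x hx
    simp only [pow_zero, Module.End.one_apply] at h2
    linarith

/-- The Cayley transform `(1 + T) (1 - T)⁻¹` carries the half plane to the disc. A form it contracts
satisfies `q (x + T x) (x + T x) < q (x - T x) (x - T x)`, that is, `4 q x (T x) < 0`. -/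
theorem exists_isLyapunov_continuous [FiniteDimensional ℝ E] {T : E →ₗ[ℝ] E}
    (hT : StableOn TimeDomain.continuous T ⊤) :
    ∃ q : LinearMap.BilinForm ℝ E, q.IsSymm ∧ (∀ x, x ≠ 0 → 0 < q x x) ∧
      ∀ x, x ≠ 0 → q x (T x) < 0 := by
  have hinj : Function.Injective (LinearMap.id - T : E →ₗ[ℝ] E) := by
    rw [injective_iff_map_eq_zero]
    intro x hx
    by_contra hx0
    have : T x = x := (sub_eq_zero.1 hx).symm
    have := hT 1 x trivial 0 trivial (Or.inl hx0) (by simp [this]) (by simp)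
    simp [TimeDomain.goodRegion] at this
    linarith
  let S : E ≃ₗ[ℝ] E := LinearEquiv.ofInjectiveEndo (LinearMap.id - T) hinj
  have hS : ∀ x, S x = x - T x := fun x => rfl
  have hU : StableOn TimeDomain.discrete ((LinearMap.id + T) ∘ₗ S.symm.toLinearMap) ⊤ := by
    intro z x' _ y' _ hxy hx hy
    obtain ⟨x, rfl⟩ := S.surjective x'
    obtain ⟨y, rfl⟩ := S.surjective y'
    simp only [LinearMap.comp_apply, LinearEquiv.coe_coe, LinearEquiv.symm_apply_apply,
      LinearMap.add_apply, LinearMap.id_apply] at hx hy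
    simp only [hS] at hx hy
    obtain ⟨a, b⟩ := z
    simp only at hx hy
    have hxy' : x ≠ 0 ∨ y ≠ 0 := by simpa using hxy
    -- The transform is inverted: `T` has the eigenvalue `(z - 1) / (z + 1)`, here with the
    -- denominator `|z + 1| ^ 2` cleared. The value `z = -1` is impossible since it would force `2 x
    -- = 2 y = 0`.
    have e1 : ((1 + a) ^ 2 + b ^ 2) • T x = (a ^ 2 + b ^ 2 - 1) • x - (2 * b) • y := by
      linear_combination (norm := module) (1 + a) • hx + b • hy
    have e2 : ((1 + a) ^ 2 + b ^ 2) • T y = (2 * b) • x + (a ^ 2 + b ^ 2 - 1) • y := by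
      linear_combination (norm := module) (1 + a) • hy - b • hx
    have hd : (1 + a) ^ 2 + b ^ 2 ≠ 0 := by
      intro h0
      have hb : b = 0 := by nlinarith [sq_nonneg (1 + a), sq_nonneg b]
      have ha : a = -1 := by
        subst hb
        have : (1 + a) ^ 2 = 0 := by linarith
        have := pow_eq_zero_iff (two_ne_zero) |>.1 this
        linarith
      subst hb ha
      rcases hxy' with hx0 | hy0
      · exact hx0 ((smul_eq_zero_iff_right (two_ne_zero (α := ℝ))).1 (by linear_combination (norm := module) hx))
      · exact hy0 ((smul_eq_zero_iff_right (two_ne_zero (α := ℝ))).1 (by linear_combination (norm := module) hy))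
    set d := (1 + a) ^ 2 + b ^ 2 with hd_def
    have hdpos : 0 < d := lt_of_le_of_ne (by positivity) (Ne.symm hd)
    have f1 : T x = ((a ^ 2 + b ^ 2 - 1) / d) • x - (2 * b / d) • y := by
      have := congrArg (fun w => d⁻¹ • w) e1
      simp only [smul_smul, inv_mul_cancel₀ hd, one_smul, smul_sub] at this
      rw [this]; congr 2 <;> ring
    have f2 : T y = (2 * b / d) • x + ((a ^ 2 + b ^ 2 - 1) / d) • y := by
      have := congrArg (fun w => d⁻¹ • w) e2
      simp only [smul_smul, inv_mul_cancel₀ hd, one_smul, smul_add] at this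
      rw [this]; congr 2 <;> ring
    have := hT ⟨(a ^ 2 + b ^ 2 - 1) / d, 2 * b / d⟩ x trivial y trivial hxy' f1 f2
    simp only [TimeDomain.goodRegion, Set.mem_ofPred_eq, div_neg_iff] at this ⊢
    have hlt : a ^ 2 + b ^ 2 < 1 := by
      rcases this with h | h
      · linarith [h.2]
      · linarith [h.1]
    rw [← sq_lt_one_iff₀ (norm_nonneg _), ← Complex.normSq_eq_norm_sq, Complex.normSq_mk]
    nlinarith
  obtain ⟨q, hsymm, hpos, hq⟩ := exists_isLyapunov_discrete hU
  refine ⟨q, hsymm, hpos, fun x hx => ?_⟩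
  have := hq (S x) (by simpa using hx)
  simp only [LinearMap.comp_apply, LinearEquiv.coe_coe, LinearEquiv.symm_apply_apply,
      LinearMap.add_apply, LinearMap.id_apply] at this
  simp only [hS, map_add, map_sub, LinearMap.add_apply, LinearMap.sub_apply] at this
  have hs := hsymm.eq x (T x)
  linarith

theorem exists_isLyapunov [FiniteDimensional ℝ E] {td : TimeDomain} {T : E →ₗ[ℝ] E}
    (hT : StableOn td T ⊤) :
    ∃ q : LinearMap.BilinForm ℝ E, q.IsSymm ∧ (∀ x, x ≠ 0 → 0 < q x x) ∧ IsLyapunov td T q := by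
  cases td
  · exact exists_isLyapunov_continuous hT
  · exact exists_isLyapunov_discrete hT

/-- The compression of a strictly dissipative (contractive) operator to the orthogonal complement
of a subspace `K` is stable. -/
theorem IsLyapunov.mem_goodRegion {td : TimeDomain} {T : E →ₗ[ℝ] E} {q : LinearMap.BilinForm ℝ E}
    (hL : IsLyapunov td T q) (hsymm : q.IsSymm) (hpos : ∀ x, x ≠ 0 → 0 < q x x)
    {K : Submodule ℝ E} {x y : E} (hx : x ∈ q.orthogonal K) (hy : y ∈ q.orthogonal K)
    (hxy : x ≠ 0 ∨ y ≠ 0) {z : ℂ} (h1 : T x - (z.re • x - z.im • y) ∈ K)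
    (h2 : T y - (z.im • x + z.re • y) ∈ K) : z ∈ td.goodRegion := by
  have hnn : ∀ x, 0 ≤ q x x := by
    intro x
    by_cases hx : x = 0
    · simp [hx]
    · exact (hpos x hx).le
  have hs : ∀ u v, q u v = q v u := fun u v => by simpa using hsymm.eq u v
  have hsum : 0 < q x x + q y y := by
    rcases hxy with h | h
    · linarith [hpos x h, hnn y]
    · linarith [hpos y h, hnn x]
  have hox : ∀ k ∈ K, q k x = 0 := fun k hk => hx k hk
  have hoy : ∀ k ∈ K, q k y = 0 := fun k hk => hy k hk
  -- Since `k` and `l` are orthogonal to `x` and `y`, the Lyapunov inequalities add up to `Re z * (q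
  -- x x + q y y) < 0`, respectively `|z| ^ 2 * (q x x + q y y) + q k k + q l l < q x x + q y y`.
  obtain ⟨k, hk, hk'⟩ : ∃ k ∈ K, T x = (z.re • x - z.im • y) + k := ⟨_, h1, by abel⟩
  obtain ⟨l, hl, hl'⟩ : ∃ l ∈ K, T y = (z.im • x + z.re • y) + l := ⟨_, h2, by abel⟩
  have a1 := hox k hk
  have a2 := hoy k hk
  have a3 := hox l hl
  have a4 := hoy l hl
  have a5 := (hs x k).trans a1
  have a6 := (hs y k).trans a2
  have a7 := (hs x l).trans a3
  have a8 := (hs y l).trans a4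
  have hxy_symm := hs x y
  cases td
  · have d1 : q x (T x) ≤ 0 := by
      by_cases h : x = 0
      · simp [h]
      · exact (hL x h).le
    have d2 : q y (T y) ≤ 0 := by
      by_cases h : y = 0
      · simp [h]
      · exact (hL y h).le
    have d : q x (T x) + q y (T y) < 0 := by
      rcases hxy with h | h
      · linarith [hL x h]
      · linarith [hL y h]
    rw [hk', hl'] at d
    simp only [map_add, map_sub, map_smul, smul_eq_mul, a5, a8, hxy_symm] at d
    simp only [TimeDomain.goodRegion, Set.mem_ofPred_eq]
    by_contra! hc
    nlinarith
  · have d1 : q (T x) (T x) ≤ q x x := by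
      by_cases h : x = 0
      · simp [h]
      · exact (hL x h).le
    have d2 : q (T y) (T y) ≤ q y y := by
      by_cases h : y = 0
      · simp [h]
      · exact (hL y h).le
    have d : q (T x) (T x) + q (T y) (T y) < q x x + q y y := by
      rcases hxy with h | h
      · linarith [hL x h]
      · linarith [hL y h]
    rw [hk', hl'] at d
    simp only [map_add, map_sub, map_smul, smul_eq_mul, LinearMap.add_apply, LinearMap.sub_apply,
      LinearMap.smul_apply, a1, a2, a3, a4, a5, a6, a7, a8, hxy_symm] at d
    have hk0 := hnn k
    have hl0 := hnn l
    simp only [TimeDomain.goodRegion, Set.mem_ofPred_eq]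
    rw [← sq_lt_one_iff₀ (norm_nonneg _), ← Complex.normSq_eq_norm_sq, Complex.normSq_apply]
    by_contra! hc
    nlinarith

end Lyapunov

/-! ### `𝒱⋆_g` is attained -/

namespace LTISystem

variable {n m : ℕ} {q : Type} {td : TimeDomain} {sys : LTISystem n m q}

theorem isStabOutputNulling_iff {V : Submodule ℝ (Fin n → ℝ)} :
    sys.IsStabOutputNulling td V ↔ ∃ F : Matrix (Fin m) (Fin n) ℝ,
      (∀ v ∈ V, (sys.A + sys.B * F) *ᵥ v ∈ V) ∧ (∀ v ∈ V, (sys.C + sys.D * F) *ᵥ v = 0) ∧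
      StableOn td (sys.A + sys.B * F).mulVecLin V := by
  refine exists_congr fun F => ⟨?_, ?_⟩
  · rintro ⟨h, hC, hz⟩
    exact ⟨h, hC, (stableOn_iff_restrict h).2 hz⟩
  · rintro ⟨h, hC, hz⟩
    exact ⟨h, hC, (stableOn_iff_restrict (T := (sys.A + sys.B * F).mulVecLin) h).1 hz⟩

/-- A stable exosystem whose state parametrises `V` and which generates output-nulling
trajectories makes `V` a stabilisability output-nulling subspace. -/
theorem IsStabOutputNulling.of_parametrisation {E : Type*} [AddCommGroup E] [Module ℝ E]
    [FiniteDimensional ℝ E] (T : E →ₗ[ℝ] E) (hT : StableOn td T ⊤) (f : E →ₗ[ℝ] Fin n → ℝ)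
    (g : E →ₗ[ℝ] Fin m → ℝ) (hA : ∀ x, sys.A *ᵥ f x + sys.B *ᵥ g x = f (T x))
    (hC : ∀ x, sys.C *ᵥ f x + sys.D *ᵥ g x = 0) :
    sys.IsStabOutputNulling td (LinearMap.range f) := by
  obtain ⟨b, hsymm, hpos, hL⟩ := exists_isLyapunov hT
  -- `K` need not be `T`-invariant, so `T` may not descend to the range of `f`. Lifting the range to
  -- the orthogonal complement of `K` makes the closed loop a compression of `T`, which is stable.
  let K := LinearMap.ker f
  have hcompl : IsCompl K (b.orthogonal K) := by
    refine LinearMap.BilinForm.isCompl_orthogonal_of_restrict_nondegenerate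
      (LinearMap.BilinForm.IsSymm.isRefl hsymm) ?_
    rw [LinearMap.BilinForm.nondegenerate_iff_ker_eq_bot, LinearMap.ker_eq_bot']
    intro k hk
    by_contra hk0
    have h1 := hpos k (by simpa using hk0)
    have h2 := LinearMap.congr_fun hk k
    simp at h2
    linarith
  let O := b.orthogonal K
  have hinj : LinearMap.ker (f ∘ₗ O.subtype) = ⊥ := by
    rw [LinearMap.ker_eq_bot']
    intro x hx
    exact Subtype.ext (by simpa using hcompl.disjoint.le_bot ⟨hx, x.2⟩)
  obtain ⟨s, hs⟩ := LinearMap.exists_leftInverse_of_injective _ hinj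
  have hs' : ∀ x : O, s (f x) = x := fun x => LinearMap.congr_fun hs x
  have hrange : ∀ v ∈ LinearMap.range f, ∃ x : O, f x = v := by
    rintro _ ⟨x, rfl⟩
    have hx : x ∈ K ⊔ O := by rw [hcompl.sup_eq_top]; trivial
    obtain ⟨k, hk, o, ho, rfl⟩ := Submodule.mem_sup.1 hx
    exact ⟨⟨o, ho⟩, by simp [LinearMap.mem_ker.1 hk]⟩
  let F : Matrix (Fin m) (Fin n) ℝ := LinearMap.toMatrix' (g ∘ₗ O.subtype ∘ₗ s)
  have hF : ∀ x : O, F *ᵥ f x = g x := by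
    intro x
    simp only [F, LinearMap.toMatrix'_mulVec]
    simp [hs']
  have hAF : ∀ x : O, (sys.A + sys.B * F) *ᵥ f x = f (T x) := by
    intro x
    rw [Matrix.add_mulVec, ← Matrix.mulVec_mulVec, hF, hA]
  refine isStabOutputNulling_iff.2 ⟨F, ?_, ?_, ?_⟩
  · intro v hv
    obtain ⟨x, rfl⟩ := hrange v hv
    rw [hAF]
    exact ⟨_, rfl⟩
  · intro v hv
    obtain ⟨x, rfl⟩ := hrange v hv
    rw [Matrix.add_mulVec, ← Matrix.mulVec_mulVec, hF, hC]
  · intro z v hv w hw hvw h1 h2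
    obtain ⟨x, rfl⟩ := hrange v hv
    obtain ⟨y, rfl⟩ := hrange w hw
    rw [Matrix.mulVecLin_apply, hAF] at h1 h2
    refine hL.mem_goodRegion hsymm hpos x.2 y.2 ?_ (K := K) (z := z) ?_ ?_
    · refine hvw.imp (fun h h' => h ?_) (fun h h' => h ?_) <;> simp [h']
    · simp [K, h1]
    · simp [K, h2]

/-- The two feedbacks may disagree on `V ⊓ W`, so they are run side by side on `V × W`, which
parametrises `V ⊔ W` by addition. -/
theorem IsStabOutputNulling.sup {V W : Submodule ℝ (Fin n → ℝ)}
    (hV : sys.IsStabOutputNulling td V) (hW : sys.IsStabOutputNulling td W) :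
    sys.IsStabOutputNulling td (V ⊔ W) := by
  obtain ⟨F, hF, hFC, hFs⟩ := isStabOutputNulling_iff.1 hV
  obtain ⟨G, hG, hGC, hGs⟩ := isStabOutputNulling_iff.1 hW
  have hF' : ∀ v ∈ V, (sys.A + sys.B * F).mulVecLin v ∈ V := hF
  have hG' : ∀ v ∈ W, (sys.A + sys.B * G).mulVecLin v ∈ W := hG
  have hs1 := hFs.restrict hF'
  have hs2 := hGs.restrict hG'
  have := IsStabOutputNulling.of_parametrisation (sys := sys) (td := td)
    (((sys.A + sys.B * F).mulVecLin.restrict hF').prodMap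
      ((sys.A + sys.B * G).mulVecLin.restrict hG')) ?_
    (V.subtype.coprod W.subtype)
    ((F.mulVecLin ∘ₗ V.subtype).coprod (G.mulVecLin ∘ₗ W.subtype)) ?_ ?_
  · rwa [LinearMap.range_coprod, Submodule.range_subtype, Submodule.range_subtype] at this
  · rintro z ⟨x₁, x₂⟩ - ⟨y₁, y₂⟩ - hxy h1 h2
    simp only [LinearMap.prodMap_apply, Prod.smul_mk, Prod.mk_sub_mk, Prod.mk_add_mk,
      Prod.mk.injEq] at h1 h2
    by_cases h : x₁ ≠ 0 ∨ y₁ ≠ 0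
    · exact hs1 z x₁ trivial y₁ trivial h h1.1 h2.1
    · push Not at h
      refine hs2 z x₂ trivial y₂ trivial ?_ h1.2 h2.2
      simpa [h.1, h.2] using hxy
  · rintro ⟨x, y⟩
    simp only [LinearMap.coprod_apply, LinearMap.prodMap_apply, Submodule.subtype_apply,
      LinearMap.comp_apply, Matrix.mulVecLin_apply, LinearMap.coe_restrict_apply,
      Matrix.add_mulVec, Matrix.mulVec_add, Matrix.mulVec_mulVec]
    abel
  · rintro ⟨x, y⟩
    have h1 := hFC x x.2
    have h2 := hGC y y.2
    simp only [Matrix.add_mulVec, ← Matrix.mulVec_mulVec] at h1 h2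
    simp only [LinearMap.coprod_apply, Submodule.subtype_apply,
      LinearMap.comp_apply, Matrix.mulVecLin_apply, Matrix.mulVec_add]
    linear_combination (exp := 1) h1 + h2

/-- In a Noetherian lattice a nonempty family closed under binary suprema contains its supremum. -/
theorem isStabOutputNulling_Vg : sys.IsStabOutputNulling td (sys.Vg td) := by
  have h := CompleteLattice.WellFoundedGT.isSupClosedCompact (Submodule ℝ (Fin n → ℝ))
    inferInstance {V | sys.IsStabOutputNulling td V}
  refine h ⟨⊥, ?_⟩ fun V hV W hW => hV.sup hW
  refine isStabOutputNulling_iff.2 ⟨0, ?_, ?_, ?_⟩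
  · simp
  · simp
  · intro z x hx y hy hxy
    simp only [Submodule.mem_bot] at hx hy
    simp [hx, hy] at hxy

theorem IsStabOutputNulling.le_Vg {V : Submodule ℝ (Fin n → ℝ)}
    (hV : sys.IsStabOutputNulling td V) : V ≤ sys.Vg td :=
  le_sSup hV

end LTISystem

/-! ### Right invertibility and the Rosenbrock matrix -/

namespace LTISystem

variable {n m : ℕ}

/-- Block elimination: `X - A` is invertible over the rational functions, and once the state is
eliminated the transfer matrix acts on the input. -/
theorem exists_rosenbrock_right_inverse {q : Type} [Fintype q] [DecidableEq q]
    (sys : LTISystem n m q) (h : sys.IsRightInvertible) :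
    ∃ R : Matrix (Fin n ⊕ Fin m) (Fin n ⊕ q) (RatFunc ℝ), sys.rosenbrock (RatFunc.X : RatFunc ℝ) * R = 1 := by
  obtain ⟨K, hK⟩ := h
  rw [← Matrix.mulVec_surjective_iff_exists_right_inverse]
  intro y
  set A' := sys.A.map (algebraMap ℝ (RatFunc ℝ)) with hA'
  set B' := sys.B.map (algebraMap ℝ (RatFunc ℝ)) with hB'
  set C' := sys.C.map (algebraMap ℝ (RatFunc ℝ)) with hC'
  set D' := sys.D.map (algebraMap ℝ (RatFunc ℝ)) with hD'
  set N : Matrix (Fin n) (Fin n) (RatFunc ℝ) := (RatFunc.X : RatFunc ℝ) • 1 - A' with hN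
  have hN' : N = (charmatrix sys.A).map (algebraMap (Polynomial ℝ) (RatFunc ℝ)) := by
    ext i j
    by_cases hij : i = j
    · subst hij
      simp [hN, hA', RatFunc.algebraMap_eq_C]
    · simp [hN, hA', hij, RatFunc.algebraMap_eq_C]
  have hdet : IsUnit N.det := by
    rw [isUnit_iff_ne_zero, hN']
    have : ((charmatrix sys.A).map (algebraMap (Polynomial ℝ) (RatFunc ℝ))).det =
        algebraMap (Polynomial ℝ) (RatFunc ℝ) sys.A.charpoly := by
      rw [Matrix.charpoly, RingHom.map_det]; rfl
    rw [this]
    exact (map_ne_zero_iff _ (RatFunc.algebraMap_injective ℝ)).2 (Matrix.charpoly_monic _).ne_zero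
  have hK' : (C' * N⁻¹ * B' + D') * K = 1 := hK
  let a := y ∘ Sum.inl
  let b := y ∘ Sum.inr
  let w := K *ᵥ (b + C' *ᵥ (N⁻¹ *ᵥ a))
  let v := N⁻¹ *ᵥ (B' *ᵥ w - a)
  refine ⟨Sum.elim v w, ?_⟩
  have hy : y = Sum.elim a b := (Sum.elim_comp_inl_inr y).symm
  have hNv : N *ᵥ v = B' *ᵥ w - a := by
    simp only [v, Matrix.mulVec_mulVec]
    rw [Matrix.mul_nonsing_inv _ hdet, Matrix.one_mulVec]
  have hG : (C' * N⁻¹ * B' + D') *ᵥ w = b + C' *ᵥ (N⁻¹ *ᵥ a) := by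
    simp only [w]
    rw [Matrix.mulVec_mulVec, hK', Matrix.one_mulVec]
  have hNA : A' - (RatFunc.X : RatFunc ℝ) • 1 = -N := by rw [hN]; abel
  rw [hy, rosenbrock, Matrix.fromBlocks_mulVec]
  simp only [Sum.elim_comp_inl, Sum.elim_comp_inr, ← hA', ← hB', ← hC', ← hD']
  congr 1
  · rw [hNA, Matrix.neg_mulVec, hNv]; abel
  · simp only [v]
    rw [Matrix.add_mulVec, ← Matrix.mulVec_mulVec, ← Matrix.mulVec_mulVec] at hG
    rw [Matrix.mulVec_sub, Matrix.mulVec_sub]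
    linear_combination (exp := 1) hG

theorem rosenbrock_map {q : Type} (sys : LTISystem n m q) {R S : Type} [CommRing R] [CommRing S]
    [Algebra ℝ R] [Algebra ℝ S] (f : R →ₐ[ℝ] S) (z : R) :
    (sys.rosenbrock z).map f = sys.rosenbrock (f z) := by
  ext i j
  rcases i with i | i <;> rcases j with j | j <;>
    simp [rosenbrock, Matrix.smul_apply, Matrix.one_apply]
  split_ifs <;> simp

/-- Clear the denominators of the rational right inverse by a nonzero polynomial `g` and specialise
at a real point where `g` does not vanish. -/
theorem exists_rosenbrock_surjective {q : Type} [Fintype q] [DecidableEq q]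
    (sys : LTISystem n m q) (h : sys.IsRightInvertible) :
    ∃ (z : ℝ) (L : Matrix (Fin n ⊕ Fin m) (Fin n ⊕ q) ℝ), sys.rosenbrock z * L = 1 := by
  obtain ⟨R, hR⟩ := sys.exists_rosenbrock_right_inverse h
  obtain ⟨g, hg⟩ := IsLocalization.exist_integer_multiples_of_finite
    (nonZeroDivisors (Polynomial ℝ)) (fun ij : (Fin n ⊕ Fin m) × (Fin n ⊕ q) => R ij.1 ij.2)
  choose L hL using hg
  let L' : Matrix (Fin n ⊕ Fin m) (Fin n ⊕ q) (Polynomial ℝ) := Matrix.of fun i j => L (i, j)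
  have hL' : L'.map (algebraMap (Polynomial ℝ) (RatFunc ℝ)) =
      algebraMap (Polynomial ℝ) (RatFunc ℝ) g • R := by
    ext i j
    have := hL (i, j)
    simpa [L', Algebra.smul_def, Submonoid.smul_def] using this
  have hP : (sys.rosenbrock (Polynomial.X : Polynomial ℝ)).map
      (algebraMap (Polynomial ℝ) (RatFunc ℝ)) = sys.rosenbrock (RatFunc.X : RatFunc ℝ) := by
    have := sys.rosenbrock_map (IsScalarTower.toAlgHom ℝ (Polynomial ℝ) (RatFunc ℝ)) Polynomial.X
    simpa using this
  have hmul : sys.rosenbrock (Polynomial.X : Polynomial ℝ) * L' =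
      (g : Polynomial ℝ) • (1 : Matrix (Fin n ⊕ q) (Fin n ⊕ q) (Polynomial ℝ)) := by
    apply Matrix.map_injective (RatFunc.algebraMap_injective ℝ)
    beta_reduce
    rw [Matrix.map_mul, hP, hL', Matrix.mul_smul, hR]
    ext i j
    simp only [Matrix.smul_apply, Matrix.map_apply, Matrix.one_apply, smul_eq_mul]
    split_ifs <;> simp
  have hg0 : (g : Polynomial ℝ) ≠ 0 := nonZeroDivisors.coe_ne_zero g
  obtain ⟨z, hz⟩ := Polynomial.exists_eval_ne_zero_of_natDegree_lt_card (g : Polynomial ℝ) hg0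
    (lt_of_lt_of_le (Cardinal.natCast_lt_aleph0) (Cardinal.aleph0_le_mk ℝ))
  refine ⟨z, (Polynomial.eval z (g : Polynomial ℝ))⁻¹ • L'.map (Polynomial.aeval z), ?_⟩
  have hPz : sys.rosenbrock z =
      (sys.rosenbrock (Polynomial.X : Polynomial ℝ)).map (Polynomial.aeval z) := by
    rw [rosenbrock_map, Polynomial.aeval_X]
  rw [Matrix.mul_smul, hPz, ← Matrix.map_mul, hmul]
  ext i j
  simp only [Matrix.smul_apply, Matrix.map_apply, Matrix.one_apply, smul_eq_mul]
  split_ifs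
  · simp [Polynomial.coe_aeval_eq_eval, hz]
  · simp

theorem le_normalRank {p : ℕ} (sys : LTISystem n m (Fin p)) (h : sys.IsRightInvertible) :
    n + p ≤ sys.normalRank := by
  obtain ⟨z, L, hL⟩ := sys.exists_rosenbrock_surjective h
  -- An unbounded supremum in `ℕ` would be `0`; the number of rows bounds the rank.
  have hb : BddAbove (Set.range fun z : ℂ => (sys.rosenbrock z).rank) :=
    ⟨_, by rintro _ ⟨z, rfl⟩; exact Matrix.rank_le_card_height _⟩
  refine le_trans ?_ (le_ciSup hb (z : ℂ))
  have h1 : sys.rosenbrock (z : ℂ) = (sys.rosenbrock z).map (Algebra.ofId ℝ ℂ) :=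
    (sys.rosenbrock_map (Algebra.ofId ℝ ℂ) z).symm
  have h2 : sys.rosenbrock (z : ℂ) * L.map (Algebra.ofId ℝ ℂ) = 1 := by
    rw [h1, ← Matrix.map_mul, hL, Matrix.map_one _ (map_zero _) (map_one _)]
  have h3 := Matrix.rank_mul_le_left (sys.rosenbrock (z : ℂ)) (L.map (Algebra.ofId ℝ ℂ))
  rw [h2, Matrix.rank_one] at h3
  simpa using h3

/-- Away from the invariant zeros, the Rosenbrock matrix of a right invertible system is onto. -/
theorem exists_rosenbrock_mulVec_eq {p : ℕ} (sys : LTISystem n m (Fin p))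
    (h : sys.IsRightInvertible) {μ : ℝ} (hμ : (μ : ℂ) ∉ sys.invariantZeros)
    (y : Fin n ⊕ Fin p → ℝ) : ∃ x, sys.rosenbrock μ *ᵥ x = y := by
  have hrank : n + p ≤ (sys.rosenbrock (μ : ℂ)).rank :=
    (sys.le_normalRank h).trans (not_lt.1 hμ)
  have htop : LinearMap.range (sys.rosenbrock (μ : ℂ)).mulVecLin = ⊤ := by
    apply Submodule.eq_top_of_finrank_eq
    apply le_antisymm (Submodule.finrank_le _)
    simpa [Matrix.rank] using hrank
  obtain ⟨x, hx⟩ := LinearMap.range_eq_top.1 htop (fun i => (y i : ℂ))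
  -- The matrix and the right-hand side are real, so the real part of a complex solution is a
  -- solution.
  refine ⟨fun j => (x j).re, ?_⟩
  have h1 : sys.rosenbrock (μ : ℂ) = (sys.rosenbrock μ).map (Algebra.ofId ℝ ℂ) :=
    (sys.rosenbrock_map (Algebra.ofId ℝ ℂ) μ).symm
  ext i
  have := congrArg Complex.re (congrFun hx i)
  rw [h1] at this
  simpa [Matrix.mulVec, dotProduct, Algebra.ofId_apply, Complex.re_sum] using this

end LTISystem

/-! ### Single-mode errors as a left eigenvector condition -/

namespace LTISystem

variable {n m p : ℕ}

theorem mulVec_add_mulVec_eq {q : Type} (P : Matrix q (Fin n) ℝ) (Q : Matrix q (Fin m) ℝ)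
    (F : Matrix (Fin m) (Fin n) ℝ) (x xs : Fin n → ℝ) (us : Fin m → ℝ) :
    P *ᵥ x + Q *ᵥ control F xs us x = (P + Q * F) *ᵥ (x - xs) + (P *ᵥ xs + Q *ᵥ us) := by
  simp only [control, Matrix.mulVec_add, Matrix.add_mulVec, Matrix.mulVec_sub,
    Matrix.mulVec_mulVec]
  abel

theorem hasDerivAt_exp_mulVec (M : Matrix (Fin n) (Fin n) ℝ) (x : Fin n → ℝ) (t : ℝ) :
    HasDerivAt (fun t : ℝ => NormedSpace.exp (t • M) *ᵥ x)
      (M *ᵥ (NormedSpace.exp (t • M) *ᵥ x)) t := by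
  let := Matrix.linftyOpNormedRing (n := Fin n) (α := ℝ)
  let := Matrix.linftyOpNormedAlgebra (n := Fin n) (α := ℝ) (R := ℝ)
  have h := hasDerivAt_exp_smul_const' M t
  let l : Matrix (Fin n) (Fin n) ℝ →L[ℝ] (Fin n → ℝ) :=
    LinearMap.toContinuousLinearMap
      { toFun := fun N => N *ᵥ x
        map_add' := fun a b => Matrix.add_mulVec a b x
        map_smul' := fun c a => Matrix.smul_mulVec c a x }
  have := l.hasFDerivAt.comp_hasDerivAt t h
  rw [Matrix.mulVec_mulVec]
  exact this

/-- If the rows of `C + D F` are left eigenvectors of `A + B F`, every error component is a pure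
mode along every trajectory. -/
theorem hasSingleModeErrors_of_rows {td : TimeDomain} (sys : LTISystem n m (Fin p))
    {F : Matrix (Fin m) (Fin n) ℝ} {lam : Fin p → ℝ}
    (h : ∀ x k, ((sys.C + sys.D * F) *ᵥ ((sys.A + sys.B * F) *ᵥ x)) k =
      lam k * ((sys.C + sys.D * F) *ᵥ x) k)
    {r : Fin p → ℝ} {xs : Fin n → ℝ} {us : Fin m → ℝ} (hs : sys.IsSteadyState td r xs us) :
    sys.HasSingleModeErrors td F lam r xs us := by
  cases td
  · intro x hx
    obtain ⟨hs1, hs2⟩ := hs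
    simp only [TimeDomain.constFreq, zero_smul] at hs1
    simp only [mulVec_add_mulVec_eq, ← hs1, ← hs2, add_zero, add_sub_cancel_right] at hx ⊢
    refine ⟨fun k => ((sys.C + sys.D * F) *ᵥ (x 0 - xs)) k, fun t ht k => ?_⟩
    obtain ⟨l, hl⟩ : ∃ l : (Fin n → ℝ) →L[ℝ] ℝ, ∀ v, l v = ((sys.C + sys.D * F) *ᵥ v) k :=
      ⟨LinearMap.toContinuousLinearMap (LinearMap.proj k ∘ₗ (sys.C + sys.D * F).mulVecLin),
        fun v => rfl⟩
    -- The error times `exp (-λ t)` has zero derivative, hence is constant.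
    have hf : ∀ s : ℝ, 0 ≤ s → HasDerivWithinAt (fun s => l (x s - xs) * Real.exp (-(lam k * s)))
        0 (Set.Ici 0) s := by
      intro s hs0
      have h1 := l.hasFDerivAt.comp_hasDerivWithinAt s ((hx s hs0).sub_const xs)
      have h2 : HasDerivAt (fun s => Real.exp (-(lam k * s)))
          (Real.exp (-(lam k * s)) * (-(lam k * 1))) s :=
        (((hasDerivAt_id s).const_mul (lam k)).neg).exp
      have h3 := h1.mul h2.hasDerivWithinAt
      refine HasDerivWithinAt.congr_deriv h3 ?_
      simp only [Function.comp_apply, hl, h]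
      ring
    have hconst : l (x t - xs) * Real.exp (-(lam k * t)) =
        l (x 0 - xs) * Real.exp (-(lam k * 0)) := by
      refine (convex_Ici (0 : ℝ)).is_const_of_fderivWithin_eq_zero (𝕜 := ℝ)
        (f := fun s => l (x s - xs) * Real.exp (-(lam k * s)))
        (fun s hs0 => (hf s hs0).differentiableWithinAt) (fun s hs0 => ?_) ht
        (Set.self_mem_Ici)
      have := (hf s hs0).hasFDerivWithinAt.fderivWithin (uniqueDiffOn_Ici 0 s hs0)
      rw [this]
      ext
      simp
    beta_reduce
    rw [← hl, ← hl]
    simp only [mul_zero, neg_zero, Real.exp_zero, mul_one] at hconst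
    rw [← hconst, mul_assoc, ← Real.exp_add]
    simp
  · intro x hx
    obtain ⟨hs1, hs2⟩ := hs
    simp only [TimeDomain.constFreq, one_smul] at hs1
    simp only [mulVec_add_mulVec_eq, ← hs1, ← hs2, add_sub_cancel_right] at hx ⊢
    refine ⟨fun k => ((sys.C + sys.D * F) *ᵥ (x 0 - xs)) k, fun t k => ?_⟩
    induction t with
    | zero => simp
    | succ t ih =>
      rw [hx t, add_sub_cancel_right, h, ih]
      ring

/-- If every output component is a pure mode along every trajectory, the rows of `C + D F` are left
eigenvectors of `A + B F`. -/
theorem rows_of_hasSingleModeErrors {td : TimeDomain} (sys : LTISystem n m (Fin p))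
    {F : Matrix (Fin m) (Fin n) ℝ} {lam : Fin p → ℝ}
    (h : sys.HasSingleModeErrors td F lam 0 0 0) (x : Fin n → ℝ) (k : Fin p) :
    ((sys.C + sys.D * F) *ᵥ ((sys.A + sys.B * F) *ᵥ x)) k =
      lam k * ((sys.C + sys.D * F) *ᵥ x) k := by
  cases td
  · simp only [HasSingleModeErrors, mulVec_add_mulVec_eq, sub_zero, Matrix.mulVec_zero,
      add_zero] at h
    obtain ⟨β, hβ⟩ := h (fun t : ℝ => NormedSpace.exp (t • (sys.A + sys.B * F)) *ᵥ x)
      (fun t _ => (hasDerivAt_exp_mulVec _ x t).hasDerivWithinAt)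
    obtain ⟨l, hl⟩ : ∃ l : (Fin n → ℝ) →L[ℝ] ℝ, ∀ v, l v = ((sys.C + sys.D * F) *ᵥ v) k :=
      ⟨LinearMap.toContinuousLinearMap (LinearMap.proj k ∘ₗ (sys.C + sys.D * F).mulVecLin),
        fun v => rfl⟩
    have h0 := hβ 0 le_rfl k
    simp only [zero_smul, NormedSpace.exp_zero, Matrix.one_mulVec, mul_zero, Real.exp_zero,
      mul_one] at h0
    have d1 := (l.hasFDerivAt.comp_hasDerivAt 0
      (hasDerivAt_exp_mulVec (sys.A + sys.B * F) x 0)).hasDerivWithinAt (s := Set.Ici 0)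
    have d2 : HasDerivAt (fun s => β k * Real.exp (lam k * s))
        (β k * (Real.exp (lam k * 0) * (lam k * 1))) 0 :=
      (((hasDerivAt_id (0 : ℝ)).const_mul (lam k)).exp).const_mul (β k)
    have d3 := d1.congr (f₁ := fun s => β k * Real.exp (lam k * s))
      (fun s hs => ((hl _).trans (hβ s hs k)).symm)
      ((hl _).trans (hβ 0 le_rfl k)).symm
    -- The error formula is known only for `t ≥ 0`, so the derivatives at `0` are compared within
    -- the half line.
    have := (uniqueDiffOn_Ici (0 : ℝ) 0 Set.self_mem_Ici).eq_deriv _ d3 d2.hasDerivWithinAt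
    simp only [zero_smul, NormedSpace.exp_zero, Matrix.one_mulVec, mul_zero, Real.exp_zero,
      mul_one, one_mul, hl] at this
    rw [this, h0, mul_comm]
  · simp only [HasSingleModeErrors, mulVec_add_mulVec_eq, sub_zero, Matrix.mulVec_zero,
      add_zero] at h
    obtain ⟨β, hβ⟩ := h (fun t : ℕ => (sys.A + sys.B * F) ^ t *ᵥ x) (fun t => by
      rw [pow_succ', Matrix.mulVec_mulVec])
    have h0 := hβ 0 k
    have h1 := hβ 1 k
    simp only [pow_zero, pow_one, Matrix.one_mulVec, mul_one] at h0 h1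
    rw [h1, h0, mul_comm]

end LTISystem

/-! ### Independent representatives of subspaces -/

section Rado

variable {K E ι : Type*} [Field K] [AddCommGroup E] [Module K E]

/-- A subspace of dimension at least two is the sum of two proper subspaces. -/
theorem Submodule.exists_lt_sup_eq_of_two_le_finrank (U : Submodule K E) (h : 2 ≤ finrank K U) :
    ∃ H₁ H₂ : Submodule K E, H₁ < U ∧ H₂ < U ∧ H₁ ⊔ H₂ = U := by
  obtain ⟨u, huU, hu0⟩ : ∃ u ∈ U, u ≠ 0 :=
    U.exists_mem_ne_zero_of_ne_bot (by rintro rfl; simp at h)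
  obtain ⟨W, hW⟩ := Submodule.exists_isCompl (K ∙ u)
  have hspan : (K ∙ u) ≤ U := (Submodule.span_singleton_le_iff_mem _ _).2 huU
  refine ⟨K ∙ u, W ⊓ U, lt_of_le_of_ne hspan ?_, lt_of_le_of_ne inf_le_right ?_, ?_⟩
  · intro heq
    have := finrank_span_singleton (K := K) hu0
    rw [heq] at this
    omega
  · intro heq
    have huW : u ∈ W := (inf_eq_right.1 heq) huU
    exact hu0 (by simpa using hW.disjoint.le_bot ⟨Submodule.mem_span_singleton_self u, huW⟩)
  · rw [← sup_inf_assoc_of_le W hspan, hW.sup_eq_top, top_inf_eq]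

variable [FiniteDimensional K E] [Finite ι]

/-- Take a minimal family satisfying the condition. If some `W j` had dimension at least two, it
would be `H₁ ⊔ H₂` with proper summands; replacing it by either one violates the condition, and the
modular law makes the two violations incompatible. -/
theorem exists_one_le_finrank_of_rado [DecidableEq ι] (U : ι → Submodule K E)
    (h : ∀ S : Finset ι, S.card ≤ finrank K ↥(⨆ j ∈ S, U j)) :
    ∃ W : ι → Submodule K E, (∀ j, W j ≤ U j) ∧ (∀ j, finrank K (W j) ≤ 1) ∧
      ∀ S : Finset ι, S.card ≤ finrank K ↥(⨆ j ∈ S, W j) := by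
  obtain ⟨W, hW, hmin⟩ := WellFounded.has_min (wellFounded_lt (α := ι → Submodule K E))
    {W | W ≤ U ∧ ∀ S : Finset ι, S.card ≤ finrank K ↥(⨆ j ∈ S, W j)} ⟨U, le_rfl, h⟩
  refine ⟨W, hW.1, fun j => ?_, hW.2⟩
  by_contra! hj
  obtain ⟨H₁, H₂, h₁, h₂, hsup⟩ := (W j).exists_lt_sup_eq_of_two_le_finrank hj
  have key : ∀ H < W j, ∃ S : Finset ι, j ∉ S ∧
      finrank K ↥(H ⊔ ⨆ i ∈ S, W i) ≤ S.card := by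
    intro H hH
    have hlt : Function.update W j H < W := by
      rw [Pi.lt_def]
      refine ⟨fun i => ?_, j, by simpa using hH⟩
      by_cases hi : i = j
      · subst hi; simpa using hH.le
      · simp [hi]
    obtain ⟨S, hS⟩ : ∃ S : Finset ι, finrank K ↥(⨆ i ∈ S, Function.update W j H i) < S.card := by
      by_contra! hc
      exact hmin _ ⟨hlt.le.trans hW.1, hc⟩ hlt
    have hne : ∀ S : Finset ι, j ∉ S →
        ⨆ i ∈ S, Function.update W j H i = ⨆ i ∈ S, W i := by
      intro S hjS
      refine iSup_congr fun i => iSup_congr fun hi => ?_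
      rw [Function.update_of_ne]
      rintro rfl
      exact hjS hi
    have hjS : j ∈ S := by
      by_contra hjS
      rw [hne S hjS] at hS
      exact absurd (hW.2 S) (not_le.2 hS)
    refine ⟨S.erase j, Finset.notMem_erase j S, ?_⟩
    rw [← Finset.insert_erase hjS, Finset.iSup_insert, hne _ (Finset.notMem_erase j S),
      Function.update_self, Finset.card_insert_of_notMem (Finset.notMem_erase j S)] at hS
    omega
  obtain ⟨S₁, hj₁, hS₁⟩ := key H₁ h₁
  obtain ⟨S₂, hj₂, hS₂⟩ := key H₂ h₂
  -- The two dimensions add up to at most `|S₁| + |S₂|`, while their supremum and infimum need at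
  -- least `|S₁ ∪ S₂| + 1` and `|S₁ ∩ S₂|`.
  have hmod := Submodule.finrank_sup_add_finrank_inf_eq (H₁ ⊔ ⨆ i ∈ S₁, W i) (H₂ ⊔ ⨆ i ∈ S₂, W i)
  have hsupeq : (H₁ ⊔ ⨆ i ∈ S₁, W i) ⊔ (H₂ ⊔ ⨆ i ∈ S₂, W i) = ⨆ i ∈ insert j (S₁ ∪ S₂), W i := by
    rw [sup_sup_sup_comm, hsup, Finset.iSup_insert, Finset.iSup_union]
  have hinf : ⨆ i ∈ S₁ ∩ S₂, W i ≤ (H₁ ⊔ ⨆ i ∈ S₁, W i) ⊓ (H₂ ⊔ ⨆ i ∈ S₂, W i) := by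
    refine le_inf (le_sup_of_le_right ?_) (le_sup_of_le_right ?_)
    · exact biSup_mono fun i hi => Finset.mem_of_mem_inter_left hi
    · exact biSup_mono fun i hi => Finset.mem_of_mem_inter_right hi
  have c1 := hW.2 (insert j (S₁ ∪ S₂))
  have c2 := (hW.2 (S₁ ∩ S₂)).trans (Submodule.finrank_mono hinf)
  rw [← hsupeq, Finset.card_insert_of_notMem (by simp [hj₁, hj₂])] at c1
  have := Finset.card_union_add_card_inter S₁ S₂
  omega

/-- **Rado's theorem** for subspaces: a family of subspaces has a linearly independent system of
representatives as soon as the sum of any `k` of them has dimension at least `k`. -/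
theorem exists_linearIndependent_of_card_le_finrank (U : ι → Submodule K E)
    (h : ∀ S : Finset ι, S.card ≤ finrank K ↥(⨆ j ∈ S, U j)) :
    ∃ v : ι → E, (∀ j, v j ∈ U j) ∧ LinearIndependent K v := by
  classical
  have := Fintype.ofFinite ι
  obtain ⟨W, hWU, hW1, hW⟩ := exists_one_le_finrank_of_rado U h
  have : ∀ j, ∃ v ∈ W j, W j = K ∙ v := by
    intro j
    obtain ⟨v, hv⟩ := finrank_le_one_iff.1 (hW1 j)
    refine ⟨v, v.2, le_antisymm (fun w hw => ?_) ((Submodule.span_singleton_le_iff_mem _ _).2 v.2)⟩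
    obtain ⟨c, hc⟩ := hv ⟨w, hw⟩
    exact Submodule.mem_span_singleton.2 ⟨c, congrArg Subtype.val hc⟩
  choose v hv hspan using this
  refine ⟨v, fun j => hWU j (hv j), ?_⟩
  rw [linearIndependent_iff_card_le_finrank_span]
  have h1 := hW Finset.univ
  have h2 : ⨆ j ∈ (Finset.univ : Finset ι), W j = Submodule.span K (Set.range v) := by
    rw [Submodule.span_range_eq_iSup]
    simp [hspan]
  rw [h2] at h1
  simpa [Set.finrank] using h1

end Rado

/-! ### Modes that complete `𝒱⋆_g` -/

theorem Submodule.finrank_map_add_finrank_ker {K E E' : Type*} [Field K] [AddCommGroup E]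
    [Module K E] [FiniteDimensional K E] [AddCommGroup E'] [Module K E'] (f : E →ₗ[K] E')
    {W : Submodule K E} (h : LinearMap.ker f ≤ W) :
    finrank K (W.map f) + finrank K (LinearMap.ker f) = finrank K W := by
  have := (f.domRestrict W).finrank_range_add_finrank_ker
  rwa [LinearMap.range_domRestrict, LinearMap.ker_domRestrict,
    (Submodule.comapSubtypeEquivOfLe h).finrank_eq] at this

namespace LTISystem

variable {n m p : ℕ} {td : TimeDomain}

theorem rosenbrock_mulVec {q : Type} (sys : LTISystem n m q) (μ : ℝ) (v : Fin n → ℝ)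
    (w : Fin m → ℝ) : sys.rosenbrock μ *ᵥ Sum.elim v w =
      Sum.elim (sys.A *ᵥ v - μ • v + sys.B *ᵥ w) (sys.C *ᵥ v + sys.D *ᵥ w) := by
  rw [rosenbrock, Matrix.fromBlocks_mulVec]
  simp [Matrix.sub_mulVec, Matrix.smul_mulVec]

theorem mem_dropOutput_Rstar {sys : LTISystem n m (Fin p)} {j : Fin p} {μ : ℝ} {v : Fin n → ℝ} :
    v ∈ (sys.dropOutput j).Rstar μ ↔ ∃ w, sys.A *ᵥ v + sys.B *ᵥ w = μ • v ∧
      ∀ i ≠ j, (sys.C *ᵥ v + sys.D *ᵥ w) i = 0 := by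
  refine exists_congr fun w => ?_
  rw [rosenbrock_mulVec, ← Sum.elim_zero_zero, Sum.elim_eq_iff]
  refine and_congr ?_ ?_
  · rw [sub_add_eq_add_sub, sub_eq_zero]
    rfl
  · rw [funext_iff, Subtype.forall]
    rfl

/-- A state whose motion is a stable mode, up to a perturbation in `𝒱⋆_g`, is in `𝒱⋆_g`. -/
theorem mem_Vg_of_mode {q : Type} {sys : LTISystem n m q} {μ : ℝ}
    (hμ : (μ : ℂ) ∈ td.goodRegion) {v y : Fin n → ℝ} {w : Fin m → ℝ} (hy : y ∈ sys.Vg td)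
    (hA : sys.A *ᵥ v + sys.B *ᵥ w = μ • v + y) (hC : sys.C *ᵥ v + sys.D *ᵥ w = 0) :
    v ∈ sys.Vg td := by
  obtain ⟨F, hF, hFC, hFs⟩ := isStabOutputNulling_iff.1 (isStabOutputNulling_Vg (sys := sys)
    (td := td))
  have hF' : ∀ v ∈ sys.Vg td, (sys.A + sys.B * F).mulVecLin v ∈ sys.Vg td := hF
  have hs := hFs.restrict hF'
  -- Adjoin to the closed loop on `𝒱⋆_g` a coordinate with mode `μ` that drives it through `y`. This
  -- is block triangular, hence stable, and its state map has range `𝒱⋆_g + ℝ v`.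
  let T : (sys.Vg td × ℝ) →ₗ[ℝ] (sys.Vg td × ℝ) :=
    (((sys.A + sys.B * F).mulVecLin.restrict hF').coprod
      (LinearMap.toSpanSingleton ℝ (sys.Vg td) ⟨y, hy⟩)).prod (μ • LinearMap.snd ℝ _ ℝ)
  have hT : ∀ x c, T (x, c) =
      ((sys.A + sys.B * F).mulVecLin.restrict hF' x + c • ⟨y, hy⟩, μ * c) := fun x c => rfl
  have hTs : StableOn td T ⊤ := by
    refine StableOn.of_diagonal_quotient (T' := T) (V := LinearMap.ker (LinearMap.snd ℝ _ ℝ))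
      (ι := Unit) ?_ (fun _ _ => rfl) (LinearMap.pi fun _ => LinearMap.snd ℝ _ ℝ) (fun _ => μ)
      (fun _ => hμ) ?_ ?_
    · rintro z ⟨x, c⟩ hx ⟨x', c'⟩ hx' hne h1 h2
      obtain rfl : c = 0 := hx
      obtain rfl : c' = 0 := hx'
      rw [hT] at h1 h2
      simp only [zero_smul, add_zero, Prod.smul_mk, Prod.mk_sub_mk, Prod.mk_add_mk,
        Prod.mk.injEq] at h1 h2
      exact hs z x trivial x' trivial (by simpa using hne) h1.1 h2.1
    · rintro ⟨x, c⟩ - h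
      exact congrFun h ()
    · rintro ⟨x, c⟩ - i
      rfl
  have h := IsStabOutputNulling.of_parametrisation (sys := sys) T hTs
    ((sys.Vg td).subtype.coprod (LinearMap.toSpanSingleton ℝ _ v))
    ((F.mulVecLin ∘ₗ (sys.Vg td).subtype).coprod (LinearMap.toSpanSingleton ℝ _ w)) ?_ ?_
  · refine h.le_Vg ⟨(0, 1), by simp⟩
  · rintro ⟨x, c⟩
    rw [hT]
    have e1 : sys.A *ᵥ (x : Fin n → ℝ) + sys.B *ᵥ F *ᵥ (x : Fin n → ℝ) =
        (sys.A + sys.B * F) *ᵥ (x : Fin n → ℝ) := by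
      rw [Matrix.add_mulVec, Matrix.mulVec_mulVec]
    simp only [LinearMap.coprod_apply, Submodule.subtype_apply, LinearMap.comp_apply,
      Matrix.mulVecLin_apply, LinearMap.toSpanSingleton_apply, Matrix.mulVec_add,
      Matrix.mulVec_smul, Submodule.coe_add, Submodule.coe_smul, LinearMap.coe_restrict_apply,
      ← e1]
    linear_combination (norm := module) c • hA
  · rintro ⟨x, c⟩
    have e1 := hFC x x.2
    rw [Matrix.add_mulVec, ← Matrix.mulVec_mulVec] at e1
    simp only [LinearMap.coprod_apply, Submodule.subtype_apply, LinearMap.comp_apply,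
      Matrix.mulVecLin_apply, LinearMap.toSpanSingleton_apply, Matrix.mulVec_add,
      Matrix.mulVec_smul]
    linear_combination (norm := module) c • hC + e1

/-- If the rows of `C + D F` are left eigenvectors of a stable `A + B F`, then `ℛ⋆_j(λ_j)` has
elements on which only the `j`-th row of `C + D F` does not vanish. -/
theorem card_le_finrank_of_rows (sys : LTISystem n m (Fin p)) (hR : sys.IsRightInvertible)
    (hdim : (finrank ℝ (sys.Vg td) : ℤ) = (n : ℤ) - p) {lam : Fin p → ℝ}
    (hlam : ∀ j, (lam j : ℂ) ∈ td.goodRegion) (hlamZ : ∀ j, (lam j : ℂ) ∉ sys.invariantZeros)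
    {F : Matrix (Fin m) (Fin n) ℝ} (hF : IsAsympStable td (sys.A + sys.B * F))
    (h : ∀ x k, ((sys.C + sys.D * F) *ᵥ ((sys.A + sys.B * F) *ᵥ x)) k =
      lam k * ((sys.C + sys.D * F) *ᵥ x) k) (S : Finset (Fin p)) :
    finrank ℝ (sys.Vg td) + S.card ≤
      finrank ℝ ↥(sys.Vg td ⊔ ⨆ j ∈ S, (sys.dropOutput j).Rstar (lam j)) := by
  let L := (sys.C + sys.D * F).mulVecLin
  have hrk := L.finrank_range_add_finrank_ker
  have hrange := Submodule.finrank_le (LinearMap.range L)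
  simp only [Module.finrank_fin_fun] at hrk hrange
  have hle : LinearMap.ker L ≤ sys.Vg td := by
    refine IsStabOutputNulling.le_Vg (isStabOutputNulling_iff.2 ⟨F, ?_, fun v hv => hv, ?_⟩)
    · intro v hv
      ext k
      have hv' : (sys.C + sys.D * F) *ᵥ v = 0 := hv
      exact (h v k).trans (by rw [hv']; simp)
    · intro z x _ y _
      exact isAsympStable_iff_stableOn.1 hF z x trivial y trivial
  have hker : LinearMap.ker L = sys.Vg td :=
    Submodule.eq_of_le_of_finrank_le hle (by omega)
  have hsurj : LinearMap.range L = ⊤ := by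
    apply Submodule.eq_top_of_finrank_eq
    rw [Module.finrank_fin_fun]
    rw [hker] at hrk
    omega
  have hex : ∀ j, ∃ v ∈ (sys.dropOutput j).Rstar (lam j), L v = Pi.single j 1 := by
    intro j
    obtain ⟨v₀, hv₀⟩ := LinearMap.range_eq_top.1 hsurj (Pi.single j 1)
    have hv₀' : (sys.C + sys.D * F) *ᵥ v₀ = Pi.single j 1 := hv₀
    -- `y` measures how far `v₀` is from a `λ_j`-mode. The pair `(v, w)` cancels it with zero
    -- output, and `v ∈ 𝒱⋆_g = ker L` leaves `L v₀` unchanged.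
    let y := (sys.A + sys.B * F) *ᵥ v₀ - lam j • v₀
    have hy : y ∈ sys.Vg td := by
      rw [← hker, LinearMap.mem_ker]
      ext k
      simp only [y, L, Matrix.mulVecLin_apply, Matrix.mulVec_sub, Matrix.mulVec_smul,
        Pi.sub_apply, h, hv₀', Pi.smul_apply, Pi.zero_apply, smul_eq_mul]
      by_cases hkj : k = j
      · subst hkj; simp
      · simp [hkj]
    obtain ⟨x, hx⟩ := sys.exists_rosenbrock_mulVec_eq hR (hlamZ j) (Sum.elim (-y) 0)
    rw [← Sum.elim_comp_inl_inr x, rosenbrock_mulVec, Sum.elim_eq_iff] at hx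
    set v := x ∘ Sum.inl
    set w := x ∘ Sum.inr
    have hv : v ∈ sys.Vg td := by
      refine mem_Vg_of_mode (hlam j) (neg_mem hy) (w := w) ?_ hx.2
      linear_combination (norm := module) hx.1
    refine ⟨v₀ + v, mem_dropOutput_Rstar.2 ⟨F *ᵥ v₀ + w, ?_, fun i hi => ?_⟩, ?_⟩
    · have e1 : y = sys.A *ᵥ v₀ + sys.B *ᵥ F *ᵥ v₀ - lam j • v₀ := by
        simp only [y, Matrix.add_mulVec, Matrix.mulVec_mulVec]
      have e2 := hx.1
      rw [e1] at e2
      simp only [Matrix.mulVec_add]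
      linear_combination (norm := module) e2
    · have e1 : sys.C *ᵥ (v₀ + v) + sys.D *ᵥ (F *ᵥ v₀ + w) = Pi.single j 1 := by
        rw [Matrix.add_mulVec, ← Matrix.mulVec_mulVec] at hv₀'
        simp only [Matrix.mulVec_add]
        linear_combination (norm := module) hv₀' + hx.2
      rw [e1, Pi.single_eq_of_ne hi]
    · rw [map_add, hv₀, LinearMap.mem_ker.1 (hker ▸ hv), add_zero]
  choose v hv hLv using hex
  set W := sys.Vg td ⊔ ⨆ j ∈ S, (sys.dropOutput j).Rstar (lam j) with hW
  have hcount := Submodule.finrank_map_add_finrank_ker L (W := W) (hker ▸ le_sup_left)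
  have hli : LinearIndependent ℝ (fun j : S => (Pi.single (j : Fin p) (1 : ℝ) : Fin p → ℝ)) :=
    (Pi.linearIndependent_single_one (Fin p) ℝ).comp _ Subtype.val_injective
  have hspan : Submodule.span ℝ (Set.range fun j : S => (Pi.single (j : Fin p) (1 : ℝ) : Fin p → ℝ))
      ≤ W.map L := by
    rw [Submodule.span_le]
    rintro _ ⟨j, rfl⟩
    refine ⟨v j, ?_, hLv j⟩
    exact Submodule.mem_sup_right (Submodule.mem_iSup_of_mem (j : Fin p)
      (Submodule.mem_iSup_of_mem j.2 (hv j)))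
  have := Submodule.finrank_mono hspan
  rw [finrank_span_eq_card hli, Fintype.card_coe] at this
  rw [hker] at hcount
  omega

/-- Modes `v_j ∈ ℛ⋆_j(λ_j)` completing `𝒱⋆_g` to the whole state space yield a stabilising feedback
for which the rows of `C + D F` are left eigenvectors of `A + B F`. -/
theorem exists_feedback_of_modes (sys : LTISystem n m (Fin p)) {lam : Fin p → ℝ}
    (hlam : ∀ j, (lam j : ℂ) ∈ td.goodRegion) (φ : (Fin n → ℝ) →ₗ[ℝ] Fin p → ℝ)
    (hφ : LinearMap.ker φ = sys.Vg td) (v : Fin p → Fin n → ℝ)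
    (hv : ∀ j, v j ∈ (sys.dropOutput j).Rstar (lam j)) (hφv : ∀ j, φ (v j) = Pi.single j 1) :
    ∃ F : Matrix (Fin m) (Fin n) ℝ, IsAsympStable td (sys.A + sys.B * F) ∧
      ∀ x k, ((sys.C + sys.D * F) *ᵥ ((sys.A + sys.B * F) *ᵥ x)) k =
        lam k * ((sys.C + sys.D * F) *ᵥ x) k := by
  simp only [mem_dropOutput_Rstar] at hv
  choose w hwA hwC using hv
  obtain ⟨G, hG, hGC, hGs⟩ := isStabOutputNulling_iff.1 (isStabOutputNulling_Vg (sys := sys)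
    (td := td))
  let P : (Fin n → ℝ) →ₗ[ℝ] Fin n → ℝ := Fintype.linearCombination ℝ v ∘ₗ φ
  have hP : ∀ x, P x = ∑ j, φ x j • v j := fun x => by
    simp [P, Fintype.linearCombination_apply]
  let Q : (Fin n → ℝ) →ₗ[ℝ] Fin m → ℝ := Fintype.linearCombination ℝ w ∘ₗ φ
  have hQ : ∀ x, Q x = ∑ j, φ x j • w j := fun x => by
    simp [Q, Fintype.linearCombination_apply]
  -- `P` projects onto the span of the `v j` along `𝒱⋆_g`, so `F` agrees with `G` on `𝒱⋆_g` and
  -- sends `v j` to `w j`.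
  let F : Matrix (Fin m) (Fin n) ℝ := LinearMap.toMatrix' (G.mulVecLin ∘ₗ (LinearMap.id - P) + Q)
  have hF : ∀ x, F *ᵥ x = G *ᵥ (x - P x) + Q x := by
    intro x
    rw [LinearMap.toMatrix'_mulVec]
    rfl
  have hsum : ∀ c : Fin p → ℝ, φ (∑ j, c j • v j) = c := by
    intro c
    simp only [map_sum, map_smul, hφv]
    ext k
    simp [Finset.sum_apply, Pi.single_apply]
  have hproj : ∀ x, x - P x ∈ sys.Vg td := by
    intro x
    rw [← hφ, LinearMap.mem_ker, map_sub, hP, hsum, sub_self]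
  have hAF : ∀ x, (sys.A + sys.B * F) *ᵥ x =
      (sys.A + sys.B * G) *ᵥ (x - P x) + ∑ j, (lam j * φ x j) • v j := by
    intro x
    have e : ∑ j, (lam j * φ x j) • v j = sys.A *ᵥ P x + sys.B *ᵥ Q x := by
      simp only [hP, hQ, Matrix.mulVec_sum, Matrix.mulVec_smul, ← Finset.sum_add_distrib,
        ← smul_add, hwA, smul_smul, mul_comm]
    rw [e, Matrix.add_mulVec, ← Matrix.mulVec_mulVec, hF, Matrix.add_mulVec,
      ← Matrix.mulVec_mulVec, Matrix.mulVec_sub sys.A, Matrix.mulVec_add]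
    abel
  -- Only `v k` has a possibly nonzero `k`-th output, so row `k` is a multiple of `φ_k`; a zero
  -- multiple does no harm.
  have hCF : ∀ x k, ((sys.C + sys.D * F) *ᵥ x) k =
      φ x k * (sys.C *ᵥ v k + sys.D *ᵥ w k) k := by
    intro x k
    have e0 := hGC _ (hproj x)
    rw [Matrix.add_mulVec, ← Matrix.mulVec_mulVec, Matrix.mulVec_sub] at e0
    have e1 : (sys.C + sys.D * F) *ᵥ x = sys.C *ᵥ P x + sys.D *ᵥ Q x := by
      rw [Matrix.add_mulVec, ← Matrix.mulVec_mulVec, hF, Matrix.mulVec_add]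
      linear_combination (norm := module) e0
    have e2 : sys.C *ᵥ P x + sys.D *ᵥ Q x =
        ∑ j, φ x j • (sys.C *ᵥ v j + sys.D *ᵥ w j) := by
      simp only [hP, hQ, Matrix.mulVec_sum, Matrix.mulVec_smul, ← Finset.sum_add_distrib,
        ← smul_add]
    rw [e1, e2, Finset.sum_apply, Finset.sum_eq_single k]
    · rfl
    · intro j _ hj
      rw [Pi.smul_apply, hwC j k hj.symm, smul_zero]
    · simp
  have hφA : ∀ x k, φ ((sys.A + sys.B * F) *ᵥ x) k = lam k * φ x k := by
    intro x k
    have e0 : φ ((sys.A + sys.B * G) *ᵥ (x - P x)) = 0 := by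
      rw [← LinearMap.mem_ker, hφ]
      exact hG _ (hproj x)
    rw [hAF, map_add, e0, zero_add, hsum]
  refine ⟨F, isAsympStable_iff_stableOn.2 ?_, fun x k => ?_⟩
  · refine StableOn.of_diagonal_quotient hGs ?_ φ lam hlam ?_ ?_
    · intro x hx
      have hx0 : φ x = 0 := by rwa [← hφ] at hx
      have hPx : P x = 0 := by simp [hP, hx0]
      rw [Matrix.mulVecLin_apply, Matrix.mulVecLin_apply, hAF, hPx, sub_zero]
      simp only [hx0, Pi.zero_apply, mul_zero, zero_smul, Finset.sum_const_zero, add_zero]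
    · intro x _ hx
      rw [← hφ]
      exact hx
    · exact fun x _ k => hφA x k
  · rw [hCF, hCF, hφA, mul_assoc]

/-- Rado's theorem is applied in the quotient by `𝒱⋆_g`. The quotient has dimension `p`, so the
representatives form a basis, and `φ` reads off its coordinates. -/
theorem exists_modes_of_card_le_finrank (sys : LTISystem n m (Fin p)) {lam : Fin p → ℝ}
    (hdim : (finrank ℝ (sys.Vg td) : ℤ) = (n : ℤ) - p)
    (h : ∀ S : Finset (Fin p), finrank ℝ (sys.Vg td) + S.card ≤
      finrank ℝ ↥(sys.Vg td ⊔ ⨆ j ∈ S, (sys.dropOutput j).Rstar (lam j))) :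
    ∃ (φ : (Fin n → ℝ) →ₗ[ℝ] Fin p → ℝ) (v : Fin p → Fin n → ℝ),
      LinearMap.ker φ = sys.Vg td ∧ (∀ j, v j ∈ (sys.dropOutput j).Rstar (lam j)) ∧
      ∀ j, φ (v j) = Pi.single j 1 := by
  obtain ⟨u, hu, hli⟩ := exists_linearIndependent_of_card_le_finrank
    (fun j => ((sys.dropOutput j).Rstar (lam j)).map (sys.Vg td).mkQ) (fun S => by
      have h1 := Submodule.finrank_map_add_finrank_ker (sys.Vg td).mkQ
        (W := sys.Vg td ⊔ ⨆ j ∈ S, (sys.dropOutput j).Rstar (lam j)) (by simp)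
      rw [Submodule.ker_mkQ, Submodule.map_sup, Submodule.mkQ_map_self, bot_sup_eq] at h1
      have hmap : (⨆ j ∈ S, (sys.dropOutput j).Rstar (lam j)).map (sys.Vg td).mkQ =
          ⨆ j ∈ S, ((sys.dropOutput j).Rstar (lam j)).map (sys.Vg td).mkQ := by
        simp only [Submodule.map_iSup]
      rw [hmap] at h1
      have := h S
      omega)
  choose v hv hvu using hu
  have hcard : Fintype.card (Fin p) = finrank ℝ ((Fin n → ℝ) ⧸ sys.Vg td) := by
    have := (sys.Vg td).finrank_quotient_add_finrank
    rw [Module.finrank_fin_fun] at this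
    rw [Fintype.card_fin]
    omega
  let b : Basis (Fin p) ℝ ((Fin n → ℝ) ⧸ sys.Vg td) :=
    Basis.mk hli (hli.span_eq_top_of_card_eq_finrank' hcard).ge
  have hb : ∀ j, b j = u j := fun j => Basis.mk_apply _ _ j
  refine ⟨b.equivFun.toLinearMap ∘ₗ (sys.Vg td).mkQ, v, ?_, hv, fun j => ?_⟩
  · rw [LinearEquiv.ker_comp, Submodule.ker_mkQ]
  · rw [LinearMap.comp_apply, hvu, ← hb]
    ext k
    simp [Pi.single_apply, eq_comm]

end LTISystem

theorem mainTheorem4 (td : TimeDomain) {n m p : ℕ} (sys : LTISystem n m (Fin p))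
    (hsys : sys.IsNonredundant)
    (hA1 : sys.TrackingAssumption td)
    (hA2 : sys.DistinctGoodZeros td)
    (hdim : (finrank ℝ (sys.Vg td) : ℤ) = (n : ℤ) - p)
    (lam : Fin p → ℝ) (hlam : ∀ j, lam j ∈ td.goodReals)
    (hlamZ : ∀ j, (lam j : ℂ) ∉ sys.invariantZeros) :
    sys.MonotonicTrackingSolvable td lam ↔
      ∀ S : Finset (Fin p),
        (n : ℤ) - p + S.card ≤
          (finrank ℝ ↥(sys.Vg td ⊔ ⨆ j ∈ S, (sys.dropOutput j).Rstar (lam j)) : ℤ) := by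
  have hgood : ∀ j, (lam j : ℂ) ∈ td.goodRegion := fun j => TimeDomain.goodReals_subset (hlam j)
  rw [← hdim]
  constructor
  · rintro ⟨F, hF, h⟩ S
    -- The zero reference with the zero equilibrium already determines the rows.
    have hrows := sys.rows_of_hasSingleModeErrors (h 0 0 0 (by simp [LTISystem.IsSteadyState]))
    exact_mod_cast sys.card_le_finrank_of_rows hA1.1 hdim hgood hlamZ hF hrows S
  · intro h
    obtain ⟨φ, v, hφ, hv, hφv⟩ := sys.exists_modes_of_card_le_finrank hdim
      (fun S => by exact_mod_cast h S)
    obtain ⟨F, hF, hrows⟩ := sys.exists_feedback_of_modes hgood φ hφ v hv hφv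
    exact ⟨F, hF, fun r xs us hs => sys.hasSingleModeErrors_of_rows hrows hs⟩
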